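/- **Conventions.** A forcing notion is a set with a reflexive and transitive relation $\le$ (the stronger condition is the larger one) which has a weakest element $\emptyset_{\mathbb P}$ such that no other condition is equivalent to $\emptyset_{\mathbb P}$. *Topological sweetness.* Let $\tau$ be a topology on a forcing notion $\mathbb P$. The pair $(\mathbb P,\tau)$ is a *model of topological sweetness* if (i) $\tau$ has a countable basis; (ii) $\emptyset_{\mathbb P}$ is an isolated point; (iii) whenever a sequence $\langle p_n:n<\omega\rangle$ in $\mathbb P$ $\tau$-converges to $p\in\mathbb P$, $q\ge p$ and $W$ is a $\tau$-neighbourhood of $q$, there is $r\in W$ with $r\ge q$ such that $\{n<\omega:p_n\le r\}$ is infinite. *Extension.* A model $(\mathbb P_1,\tau_1)$ of topological sweetness *extends* the model $(\mathbb P_0,\tau_0)$ if $\mathbb P_0$ is a complete suborder of $\mathbb P_1$ (the order and the incompatibility relation of $\mathbb P_0$ are inherited from $\mathbb P_1$, and each maximal antichain of $\mathbb P_0$ is a maximal antichain of $\mathbb P_1$), $\mathbb P_0$ is a $\tau_1$-open subset of $\mathbb P_1$, and $\tau_1$ restricted to $\mathbb P_0$ is $\tau_0$. *Iterable sweetness.*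 Let $\mathcal B$ be a countable basis of a topology on a forcing notion $\mathbb Q$. The pair $(\mathbb Q,\mathcal B)$ is a *model of iterable sweetness* if (i) $\mathcal B$ is closed under finite (non-empty) intersections; (ii) each $U\in\mathcal B$ is directed (any two elements of $U$ have an upper bound in $U$) and $p\le q\in U$ implies $p\in U$; (iii) if $U\in\mathcal B$, $p_n\in U$ for all $n\le\omega$ and $\langle p_n:n<\omega\rangle$ converges to $p_\omega$ in the topology with basis $\mathcal B$, then there is $p\in U$ with $p_n\le p$ for all $n\le\omega$. *Iteration.* For a $\mathbb P$-name $\dot{\mathbb Q}$ for a forcing notion, with a name $\dot\emptyset_{\dot{\mathbb Q}}$ for its weakest element, $\mathbb P*\dot{\mathbb Q}$ consists of the pairs $(p,\dot q)$ with $p\in\mathbb P$ and $\dot q$ a $\mathbb P$-name such that $\Vdash_{\mathbb P}\dot q\in\dot{\mathbb Q}$, ordered by $(p,\dot q)\le(p',\dot q')$ iff $p\le p'$ and $p'\Vdash\dot q\le\dot q'$. All names are admitted here, so $\mathbb P*\dot{\mathbb Q}$ is a class. **Theorem.** Suppose that $(\mathbb P,\tau)$ is a model of topological sweetness, and that $\dot{\mathbb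 Q}$ is a $\mathbb P$-name for a forcing notion and $\dot{\mathcal B}$ is a $\mathbb P$-name such that $$\Vdash_{\mathbb P}\text{``}(\dot{\mathbb Q},\dot{\mathcal B})\text{ is a model of iterable sweetness''}.$$ Then there are a dense subset $\mathbb R$ of $\mathbb P*\dot{\mathbb Q}$ (dense: every condition of $\mathbb P*\dot{\mathbb Q}$ has a stronger one in $\mathbb R$; $\mathbb R$ is a set, not a proper class) and a topology $\tau^*$ on $\mathbb R$ such that $(p,\dot\emptyset_{\dot{\mathbb Q}})\in\mathbb R$ for all $p\in\mathbb P$, the pair $(\mathbb R,\tau^*)$ is a model of topological sweetness, and, when $p\in\mathbb P$ is identified with $(p,\dot\emptyset_{\dot{\mathbb Q}})$, it extends the model $(\mathbb P,\tau)$; in particular $\mathbb P$ is a $\tau^*$-open subset of $\mathbb R$. -/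

import Mathlib

open Filter Topology

universe u v w

/-! ### The language of set theory

Formulas of the language `{∈, =}` with parameters from a universe `V` of objects; a quantifier binds
a variable that ranges over `V`. Below, `V` is the class of `P`-names. -/

/-- Formulas of set theory with parameters from `V`. -/
inductive SetFormula (V : Type v) : Type v
  | mem (x y : V) : SetFormula V
  | eq (x y : V) : SetFormula V
  | neg (φ : SetFormula V) : SetFormula V
  | and (φ ψ : SetFormula V) : SetFormula V
  | or (φ ψ : SetFormula V) : SetFormula V
  | imp (φ ψ : SetFormula V) : SetFormula V
  | all (φ : V → SetFormula V) : SetFormula V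
  | ex (φ : V → SetFormula V) : SetFormula V

namespace SetFormula

variable {V : Type v}

/-- `φ ↔ ψ` -/
def iff (φ ψ : SetFormula V) : SetFormula V := (φ.imp ψ).and (ψ.imp φ)

/-- `∀ x ∈ a, φ x` -/
def allIn (a : V) (φ : V → SetFormula V) : SetFormula V := all fun x => (mem x a).imp (φ x)

/-- `∃ x ∈ a, φ x` -/
def exIn (a : V) (φ : V → SetFormula V) : SetFormula V := ex fun x => (mem x a).and (φ x)

/-- `z = {a, b}` -/
def isUPair (z a b : V) : SetFormula V := all fun x => (mem x z).iff ((eq x a).or (eq x b))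

/-- `z = ⟨a, b⟩ = {{a}, {a, b}}` -/
def isPair (z a b : V) : SetFormula V :=
  all fun x => (mem x z).iff ((isUPair x a a).or (isUPair x a b))

/-- `⟨a, b⟩ ∈ r`. For a relation `r` this says `a r b`, for a function `r` it says `r(a) = b`. -/
def rel (r a b : V) : SetFormula V := ex fun z => (isPair z a b).and (mem z r)

/-- `∅ ∈ I`, and `n ∪ {n} ∈ I` whenever `n ∈ I`. -/
def isInductive (I : V) : SetFormula V :=
  (exIn I fun z => all fun x => (mem x z).neg).and
    (allIn I fun n => exIn I fun m => all fun x => (mem x m).iff ((mem x n).or (eq x n)))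

/-- `o = ω`, i.e. `o` is the least inductive set. -/
def isOmega (o : V) : SetFormula V :=
  (isInductive o).and (all fun I => (isInductive I).imp (allIn o fun n => mem n I))

/-- `f` is a function with domain `a`. -/
def isFunctionOn (f a : V) : SetFormula V :=
  (allIn f fun z => exIn a fun n => ex fun x => isPair z n x).and
    ((allIn a fun n => ex fun x => rel f n x).and
      (allIn a fun n => all fun x => all fun y => (rel f n x).imp ((rel f n y).imp (eq x y))))

/-- `B` is countable: some function with domain `ω` has all elements of `B` among its values. -/
def isCountable (B : V) : SetFormula V :=
  ex fun o => ex fun f =>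
    (isOmega o).and ((isFunctionOn f o).and (allIn B fun U => exIn o fun n => rel f n U))

/-- `e` is a weakest element of `(Q, le)`, and no other element of `Q` is equivalent to it
(a stronger condition is the larger one). -/
def isWeakest (Q le e : V) : SetFormula V :=
  (mem e Q).and
    ((allIn Q fun q => rel le e q).and (allIn Q fun q => (rel le q e).imp (eq q e)))

/-- `(Q, le, e)` is a forcing notion: `le` is reflexive and transitive on `Q`, and `e` is the
weakest element. -/
def isForcingNotion (Q le e : V) : SetFormula V :=
  (allIn Q fun q => rel le q q).and
    ((allIn Q fun q₀ => allIn Q fun q₁ => allIn Q fun q₂ =>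
        (rel le q₀ q₁).imp ((rel le q₁ q₂).imp (rel le q₀ q₂))).and
      (isWeakest Q le e))

/-- `B` is a basis of a topology on the set `Q`. -/
def isBasis (Q B : V) : SetFormula V :=
  (allIn B fun U => allIn U fun q => mem q Q).and
    ((allIn Q fun q => exIn B fun U => mem q U).and
      (allIn B fun U₀ => allIn B fun U₁ => all fun q => (mem q U₀).imp ((mem q U₁).imp
        (exIn B fun W => (mem q W).and (allIn W fun x => (mem x U₀).and (mem x U₁))))))

/-- For `o = ω` and a function `f` on `ω`: the sequence `f` converges to `x` in the topology with
basis `B` (every basic neighbourhood of `x` contains all but finitely many terms). -/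
def converges (B o f x : V) : SetFormula V :=
  allIn B fun U => (mem x U).imp (exIn o fun N => allIn o fun n => (mem N n).imp
    (all fun y => (rel f n y).imp (mem y U)))

/-- `(Q, B)` is a model of iterable sweetness, `Q` being ordered by `le`: `B` is a countable basis
of a topology on `Q` such that
(i) `B` is closed under finite intersections,
(ii) every `U ∈ B` is directed and downward closed,
(iii) if `U ∈ B` contains all terms of a converging sequence and its limit, then these have a
common upper bound in `U`. -/
def isIterableSweetnessModel (Q le B : V) : SetFormula V :=
  (isBasis Q B).and
    ((isCountable B).and
      ((allIn B fun U₀ => allIn B fun U₁ => exIn B fun W =>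
          all fun x => (mem x W).iff ((mem x U₀).and (mem x U₁))).and
        ((allIn B fun U =>
            (allIn U fun p => allIn U fun q => exIn U fun r => (rel le p r).and (rel le q r)).and
            (allIn Q fun p => allIn U fun q => (rel le p q).imp (mem p U))).and
          (all fun o => (isOmega o).imp (allIn B fun U => all fun f => (isFunctionOn f o).imp
            ((allIn o fun n => all fun y => (rel f n y).imp (mem y U)).imp
              (allIn U fun x => (converges B o f x).imp
                (exIn U fun p =>
                  (allIn o fun n => all fun y => (rel f n y).imp (rel le y p)).and
                    (rel le x p)))))))))

end SetFormula

/-! ### Names and the forcing relation -/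

/-- `P`-names: a `P`-name is a set (indexed by some `ι`) of pairs (name, condition). -/
inductive PName (P : Type u) : Type (u + 1)
  | mk (ι : Type u) (val : ι → PName P) (cond : ι → P) : PName P

namespace PName

variable {P : Type u} [Preorder P]

/-- `ForcesEq x y p` is `p ⊩ x = y`, i.e. for all `(x', s) ∈ x` every `q ≥ p, s` forces `x' ∈ y`,
and vice versa. -/
def ForcesEq : PName P → PName P → P → Prop
  | mk ι x s, mk κ y t => fun p =>
    (∀ (i : ι) (q : P), p ≤ q → s i ≤ q →
      ∃ r, q ≤ r ∧ ∃ j : κ, t j ≤ r ∧ ForcesEq (x i) (y j) r) ∧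
    (∀ (j : κ) (q : P), p ≤ q → t j ≤ q →
      ∃ r, q ≤ r ∧ ∃ i : ι, s i ≤ r ∧ ForcesEq (x i) (y j) r)

/-- `ForcesMem x y p` is `p ⊩ x ∈ y`: the conditions `r` with `r ≥ t` and `r ⊩ x = y'` for some
`(y', t) ∈ y` are dense above `p`. -/
def ForcesMem (x : PName P) : PName P → P → Prop
  | mk κ y t => fun p => ∀ q, p ≤ q → ∃ r, q ≤ r ∧ ∃ j : κ, t j ≤ r ∧ ForcesEq x (y j) r

end PName

/-- The forcing relation: `Forces φ p` is `p ⊩ φ`. Larger conditions are stronger. -/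
def Forces {P : Type u} [Preorder P] : SetFormula (PName P) → P → Prop
  | .mem x y, p => PName.ForcesMem x y p
  | .eq x y, p => PName.ForcesEq x y p
  | .neg φ, p => ∀ q, p ≤ q → ¬ Forces φ q
  | .and φ ψ, p => Forces φ p ∧ Forces ψ p
  | .or φ ψ, p => ∀ q, p ≤ q → ∃ r, q ≤ r ∧ (Forces φ r ∨ Forces ψ r)
  | .imp φ ψ, p => ∀ q, p ≤ q → Forces φ q → Forces ψ q
  | .all φ, p => ∀ x, Forces (φ x) p
  | .ex φ, p => ∀ q, p ≤ q → ∃ r, q ≤ r ∧ ∃ x, Forces (φ x) r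

/-- `⊩ φ`: every condition forces `φ`. -/
def Forced {P : Type u} [Preorder P] (φ : SetFormula (PName P)) : Prop := ∀ p : P, Forces φ p

theorem PName.ForcesEq.mono {P : Type u} [Preorder P] {x y : PName P} {p q : P}
    (h : PName.ForcesEq x y p) (hpq : p ≤ q) : PName.ForcesEq x y q := by
  cases x; cases y
  exact ⟨fun i r hr => h.1 i r (hpq.trans hr), fun j r hr => h.2 j r (hpq.trans hr)⟩

theorem Forces.mono {P : Type u} [Preorder P] {φ : SetFormula (PName P)} {p q : P}
    (h : Forces φ p) (hpq : p ≤ q) : Forces φ q := by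
  induction φ with
  | mem x y => cases y; exact fun r hr => h r (hpq.trans hr)
  | eq x y => exact PName.ForcesEq.mono h hpq
  | neg φ _ => exact fun r hr => h r (hpq.trans hr)
  | and φ ψ h₁ h₂ => exact ⟨h₁ h.1, h₂ h.2⟩
  | or φ ψ _ _ => exact fun r hr => h r (hpq.trans hr)
  | imp φ ψ _ _ => exact fun r hr => h r (hpq.trans hr)
  | all φ ih => exact fun x => ih x (h x)
  | ex φ _ => exact fun r hr => h r (hpq.trans hr)

/-! ### Two-step iterations -/

/-- A `P`-name for a forcing notion: names for the underlying set, the order and the weakest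
element, such that it is forced that these form a forcing notion. -/
structure ForcingName (P : Type u) [Preorder P] where
  carrier : PName P
  le : PName P
  weakest : PName P
  forced : Forced (SetFormula.isForcingNotion carrier le weakest)

/-- The iteration `P * Q`: the pairs `(p, q)` with `p ∈ P` and `q` a `P`-name such that
`⊩ q ∈ Q`. -/
structure Iteration {P : Type u} [Preorder P] (Q : ForcingName P) : Type (u + 1) where
  fst : P
  snd : PName P
  snd_mem : Forced (SetFormula.mem snd Q.carrier)

namespace Iteration

variable {P : Type u} [Preorder P]

/-- `(p, q) ≤ (p', q')` iff `p ≤ p'` and `p' ⊩ q ≤ q'`. -/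
instance (Q : ForcingName P) : Preorder (Iteration Q) where
  le a b := a.fst ≤ b.fst ∧ Forces (SetFormula.rel Q.le a.snd b.snd) b.fst
  le_refl a := ⟨le_rfl, (Q.forced a.fst).1 a.snd a.fst le_rfl (a.snd_mem _)⟩
  le_trans a b c hab hbc := by
    refine ⟨hab.1.trans hbc.1, ?_⟩
    have h := (Q.forced c.fst).2.1
    exact h a.snd c.fst le_rfl (a.snd_mem _) b.snd c.fst le_rfl (b.snd_mem _)
      c.snd c.fst le_rfl (c.snd_mem _) c.fst le_rfl (hab.2.mono hbc.1) c.fst le_rfl hbc.2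

/-- The canonical embedding `p ↦ (p, ∅_Q)` of `P` into `P * Q`. -/
def embed (Q : ForcingName P) (p : P) : Iteration Q :=
  ⟨p, Q.weakest, fun r => (Q.forced r).2.2.1⟩

end Iteration

/-! ### Topological sweetness -/

/-- `o` is a weakest condition, and no other condition is equivalent to it. -/
def IsWeakestCondition {P : Type u} [Preorder P] (o : P) : Prop :=
  (∀ p, o ≤ p) ∧ ∀ p, p ≤ o → p = o

/-- `(P, τ)` is a model of topological sweetness. -/
structure IsTopologicalSweetnessModel (P : Type u) [Preorder P] (τ : TopologicalSpace P) :
    Prop where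
  secondCountable : SecondCountableTopology P
  isolated_weakest : ∃ o : P, IsWeakestCondition o ∧ IsOpen {o}
  sweet : ∀ (s : ℕ → P) (p q : P) (W : Set P), Tendsto s atTop (𝓝 p) → p ≤ q → W ∈ 𝓝 q →
    ∃ r ∈ W, q ≤ r ∧ {n | s n ≤ r}.Infinite

/-- Two conditions are compatible if they have a common upper bound. -/
def Compatible {P : Type u} [Preorder P] (p q : P) : Prop := ∃ r, p ≤ r ∧ q ≤ r

/-- `A` is a maximal antichain: its elements are pairwise incompatible, and every condition is
compatible with one of them. -/
def IsMaximalAntichain {P : Type u} [Preorder P] (A : Set P) : Prop :=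
  A.Pairwise (fun p q => ¬ Compatible p q) ∧ ∀ p, ∃ a ∈ A, Compatible p a

/-- `i` identifies `P` with a complete suborder of `R`: the order and incompatibility of `P` are
those inherited from `R`, and maximal antichains of `P` remain maximal in `R`. -/
structure IsCompleteSuborder {P : Type u} {R : Type w} [Preorder P] [Preorder R] (i : P → R) :
    Prop where
  injective : Function.Injective i
  le_iff_le : ∀ p q, i p ≤ i q ↔ p ≤ q
  compatible_iff : ∀ p q, Compatible (i p) (i q) ↔ Compatible p q
  maximalAntichain : ∀ A : Set P, IsMaximalAntichain A → IsMaximalAntichain (i '' A)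

/-- Identifying `P` with its image under `i`, the model of topological sweetness `(R, σ)` extends
the model `(P, τ)`: `P` is a complete suborder of `R`, it is `σ`-open, and `τ` is the restriction
of `σ` to `P`. -/
structure ExtendsModel {P : Type u} {R : Type w} [Preorder P] [Preorder R] (i : P → R)
    (τ : TopologicalSpace P) (σ : TopologicalSpace R) : Prop where
  complete : IsCompleteSuborder i
  isOpen_range : IsOpen (Set.range i)
  induced : τ = TopologicalSpace.induced i σ

/-- `R` is dense in `P`: every condition has a stronger one in `R`. -/
def IsDenseSubset {P : Type u} [Preorder P] (R : Set P) : Prop := ∀ p, ∃ r ∈ R, p ≤ r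

/-! Sweetness gives `P` a form of the countable chain condition: a set of conditions is separable,
and a sequence converging to a condition has a term compatible with it. Hence the elements of the
name `B` are captured by a countable cover `S` of pairs (condition, name).

The dense set consists of the copy of `P` and of pairs `(p, x)` where `x` is taken from a small set
of representatives, is forced to stay different from the weakest element, and is decided by `p` to
lie in some `j ∈ S`. Basic open sets control the first coordinate in `τ`, and ask that some `a ∈ V`
above it decide `x` to be in `j`. As these last sets avoid the copy of `P`, and the copy itself is
declared open, the topology induced on `P` is `τ`.

For sweetness outside the copy of `P`, let `s n` converge to `l ≤ l'`. The conditions witnessing the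
decisions converge, so sweetness of `P` bounds infinitely many of them; diagonalising over the
countably many pairs `(V, j)` gives a subsequence whose second coordinates are forced to converge
(`exists_subseq`). Iterable sweetness then gives bounds in the generic extension, and mixing over an
antichain makes them one name that meets finitely many membership demands (`exists_bound_name`).
`exists_bound_of_tendsto` chooses the first coordinate so that the result lies in a given
neighbourhood of `l'`. -/

namespace PName

variable {P : Type u} [Preorder P]

/-! ### Equality and membership of names; canonical names of pairs, numbers and sequences. -/

theorem ForcesEq.refl (x : PName P) (p : P) : ForcesEq x x p := by
  induction x generalizing p with
  | mk ι x s ih =>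
    exact ⟨fun i q _ hs => ⟨q, le_rfl, i, hs, ih i q⟩, fun i q _ hs => ⟨q, le_rfl, i, hs, ih i q⟩⟩

theorem ForcesEq.symm {x y : PName P} {p : P} (h : ForcesEq x y p) : ForcesEq y x p := by
  induction x generalizing y p with
  | mk ι x s ih =>
    cases y with
    | mk κ y t =>
      refine ⟨fun j q hq ht => ?_, fun i q hq hs => ?_⟩
      · obtain ⟨r, hr, i, hi, he⟩ := h.2 j q hq ht
        exact ⟨r, hr, i, hi, ih i he⟩
      · obtain ⟨r, hr, j, hj, he⟩ := h.1 i q hq hs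
        exact ⟨r, hr, j, hj, ih i he⟩

theorem ForcesEq.trans {x y z : PName P} {p : P} (h : ForcesEq x y p) (h' : ForcesEq y z p) :
    ForcesEq x z p := by
  induction x generalizing y z p with
  | mk ι x s ih =>
    cases y with
    | mk κ y t =>
      cases z with
      | mk μ z v =>
        refine ⟨fun i q hq hs => ?_, fun l q hq hv => ?_⟩
        · obtain ⟨r, hr, j, hj, he⟩ := h.1 i q hq hs
          obtain ⟨r', hr', l, hl, he'⟩ := h'.1 j r (hq.trans hr) hj
          exact ⟨r', hr.trans hr', l, hl, ih i (he.mono hr') he'⟩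
        · obtain ⟨r, hr, j, hj, he⟩ := h'.2 l q hq hv
          obtain ⟨r', hr', i, hi, he'⟩ := h.2 j r (hq.trans hr) hj
          exact ⟨r', hr.trans hr', i, hi, ih i he' (he.mono hr')⟩

theorem ForcesEq.of_dense {x y : PName P} {p : P}
    (h : ∀ q, p ≤ q → ∃ r, q ≤ r ∧ ForcesEq x y r) : ForcesEq x y p := by
  cases x; cases y
  refine ⟨fun i q hq hs => ?_, fun j q hq ht => ?_⟩
  · obtain ⟨r, hr, he⟩ := h q hq
    obtain ⟨r', hr', h'⟩ := he.1 i r le_rfl (hs.trans hr)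
    exact ⟨r', hr.trans hr', h'⟩
  · obtain ⟨r, hr, he⟩ := h q hq
    obtain ⟨r', hr', h'⟩ := he.2 j r le_rfl (ht.trans hr)
    exact ⟨r', hr.trans hr', h'⟩

theorem ForcesMem.mono {x y : PName P} {p q : P} (h : ForcesMem x y p) (hpq : p ≤ q) :
    ForcesMem x y q := by
  cases y
  exact fun r hr => h r (hpq.trans hr)

theorem ForcesMem.of_dense {x y : PName P} {p : P}
    (h : ∀ q, p ≤ q → ∃ r, q ≤ r ∧ ForcesMem x y r) : ForcesMem x y p := by
  cases y
  intro q hq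
  obtain ⟨r, hr, hm⟩ := h q hq
  obtain ⟨r', hr', h'⟩ := hm r le_rfl
  exact ⟨r', hr.trans hr', h'⟩

theorem ForcesMem.congr_left {x x' y : PName P} {p : P} (h : ForcesMem x y p)
    (he : ForcesEq x x' p) : ForcesMem x' y p := by
  cases y
  intro q hq
  obtain ⟨r, hr, j, hj, h'⟩ := h q hq
  exact ⟨r, hr, j, hj, (he.mono (hq.trans hr)).symm.trans h'⟩

theorem ForcesMem.congr_right {x y y' : PName P} {p : P} (h : ForcesMem x y p)
    (he : ForcesEq y y' p) : ForcesMem x y' p := by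
  cases y; cases y'
  intro q hq
  obtain ⟨r, hr, j, hj, h'⟩ := h q hq
  obtain ⟨r', hr', l, hl, h''⟩ := he.1 j r (hq.trans hr) hj
  exact ⟨r', hr.trans hr', l, hl, (h'.mono hr').trans h''⟩

theorem forcesMem_val {ι : Type u} (v : ι → PName P) (s : ι → P) (i : ι) {p : P} (h : s i ≤ p) :
    ForcesMem (v i) (mk ι v s) p :=
  fun q hq => ⟨q, le_rfl, i, h.trans hq, ForcesEq.refl _ _⟩

theorem ForcesEq.ext {x y : PName P} {p : P}
    (h : ∀ z q, p ≤ q → (ForcesMem z x q ↔ ForcesMem z y q)) : ForcesEq x y p := by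
  cases x; cases y
  refine ⟨fun i q hq hs => ?_, fun j q hq ht => ?_⟩
  · exact (h _ q hq).1 (forcesMem_val _ _ i hs) q le_rfl
  · obtain ⟨r, hr, i, hi, he⟩ := (h _ q hq).2 (forcesMem_val _ _ j ht) q le_rfl
    exact ⟨r, hr, i, hi, he.symm⟩

theorem not_forcesMem_self (x : PName P) (p : P) : ¬ ForcesMem x x p := by
  induction x generalizing p with
  | mk ι v s ih =>
    intro h
    obtain ⟨r, hr, i, hi, he⟩ := h p le_rfl
    exact ih i r ((forcesMem_val v s i hi).congr_right he)

/-- The canonical name of the set of all `v i`. -/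
def ofFamily {ι : Type u} (v : ι → PName P) : PName P :=
  mk (ι × P) (fun i => v i.1) (fun i => i.2)

theorem forcesMem_ofFamily {ι : Type u} {v : ι → PName P} {x : PName P} {p : P} :
    ForcesMem x (ofFamily v) p ↔ ∀ q, p ≤ q → ∃ r, q ≤ r ∧ ∃ i, ForcesEq x (v i) r := by
  refine forall₂_congr fun q _ => ⟨?_, ?_⟩
  · rintro ⟨r, hr, i, -, he⟩
    exact ⟨r, hr, i.1, he⟩
  · rintro ⟨r, hr, i, he⟩
    exact ⟨r, hr, (i, r), le_rfl, he⟩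

/-- The canonical name of `{a, b}`. -/
def upair (a b : PName P) : PName P := ofFamily fun i : ULift.{u} Bool => cond i.down a b

theorem forcesMem_upair {a b x : PName P} {p : P} :
    ForcesMem x (upair a b) p ↔
      ∀ q, p ≤ q → ∃ r, q ≤ r ∧ (ForcesEq x a r ∨ ForcesEq x b r) := by
  rw [upair, forcesMem_ofFamily]
  refine forall₂_congr fun q _ => exists_congr fun r => and_congr_right fun _ => ⟨?_, ?_⟩
  · rintro ⟨⟨_ | _⟩, h⟩
    exacts [Or.inr h, Or.inl h]
  · rintro (h | h)
    exacts [⟨⟨true⟩, h⟩, ⟨⟨false⟩, h⟩]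

theorem forcesMem_upair_left (a b : PName P) (p : P) : ForcesMem a (upair a b) p :=
  forcesMem_upair.2 fun q _ => ⟨q, le_rfl, Or.inl (ForcesEq.refl _ _)⟩

theorem forcesMem_upair_right (a b : PName P) (p : P) : ForcesMem b (upair a b) p :=
  forcesMem_upair.2 fun q _ => ⟨q, le_rfl, Or.inr (ForcesEq.refl _ _)⟩

theorem forcesMem_singleton {a x : PName P} {p : P} :
    ForcesMem x (upair a a) p ↔ ForcesEq x a p := by
  rw [forcesMem_upair]
  simp only [or_self]
  exact ⟨ForcesEq.of_dense, fun h q hq => ⟨q, le_rfl, h.mono hq⟩⟩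

theorem ForcesEq.upair {a a' b b' : PName P} {p : P} (ha : ForcesEq a a' p)
    (hb : ForcesEq b b' p) : ForcesEq (upair a b) (upair a' b') p := by
  refine ForcesEq.ext fun z q hq => ?_
  rw [forcesMem_upair, forcesMem_upair]
  refine forall₂_congr fun s hs => exists_congr fun r => and_congr_right fun hr => ?_
  have ha' := ha.mono ((hq.trans hs).trans hr)
  have hb' := hb.mono ((hq.trans hs).trans hr)
  exact or_congr ⟨fun h => h.trans ha', fun h => h.trans ha'.symm⟩
    ⟨fun h => h.trans hb', fun h => h.trans hb'.symm⟩

/-- The canonical name of the ordered pair `⟨a, b⟩`. -/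
def pair (a b : PName P) : PName P := upair (upair a a) (upair a b)

theorem ForcesEq.pair {a a' b b' : PName P} {p : P} (ha : ForcesEq a a' p)
    (hb : ForcesEq b b' p) : ForcesEq (pair a b) (pair a' b') p :=
  (ha.upair ha).upair (ha.upair hb)

theorem ForcesEq.of_pair_left {a a' b b' : PName P} {p : P}
    (h : ForcesEq (PName.pair a b) (PName.pair a' b') p) : ForcesEq a a' p := by
  refine ForcesEq.of_dense fun q hq => ?_
  obtain ⟨r, hr, h'⟩ := forcesMem_upair.1
    ((forcesMem_upair_left (PName.upair a a) (PName.upair a b) p).congr_right h) q hq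
  refine ⟨r, hr, ?_⟩
  rcases h' with h' | h' <;>
    exact (forcesMem_singleton.1 ((forcesMem_upair_left a' _ r).congr_right h'.symm)).symm

theorem ForcesEq.of_upair_right {a b b' : PName P} {p : P}
    (h : ForcesEq (PName.upair a b) (PName.upair a b') p) : ForcesEq b b' p := by
  refine ForcesEq.of_dense fun q hq => ?_
  obtain ⟨r, hr, h₁⟩ := forcesMem_upair.1 ((forcesMem_upair_right a b p).congr_right h) q hq
  rcases h₁ with h₁ | h₁
  -- Here `b = a`, which says nothing about `b'`; the reverse inclusion gives `b' = a` or `b' = b`.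
  · obtain ⟨t, ht, h₂⟩ := forcesMem_upair.1 ((forcesMem_upair_right a b' p).congr_right h.symm) r
      (hq.trans hr)
    refine ⟨t, hr.trans ht, ?_⟩
    rcases h₂ with h₂ | h₂
    exacts [(h₁.mono ht).trans h₂.symm, h₂.symm]
  · exact ⟨r, hr, h₁⟩

theorem ForcesEq.of_pair_right {a a' b b' : PName P} {p : P}
    (h : ForcesEq (PName.pair a b) (PName.pair a' b') p) : ForcesEq b b' p := by
  have ha := h.of_pair_left
  have h' : ForcesEq (PName.pair a b) (PName.pair a b') p :=
    h.trans (ha.symm.pair (ForcesEq.refl _ _))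
  exact h'.of_upair_right.of_upair_right

/-- The canonical name of `x ∪ {x}`. -/
def succ : PName P → PName P
  | mk ι v s => mk (ι ⊕ P) (Sum.elim v fun _ => mk ι v s) (Sum.elim s id)

theorem forcesMem_succ {x y : PName P} {p : P} :
    ForcesMem y (succ x) p ↔
      ∀ q, p ≤ q → ∃ r, q ≤ r ∧ (ForcesMem y x r ∨ ForcesEq y x r) := by
  cases x with
  | mk ι v s =>
    refine ⟨fun h q hq => ?_, fun h q hq => ?_⟩
    · obtain ⟨r, hr, i | i, hi, he⟩ := h q hq
      · exact ⟨r, hr, Or.inl ((forcesMem_val v s i hi).congr_left he.symm)⟩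
      · exact ⟨r, hr, Or.inr he⟩
    · obtain ⟨r, hr, h' | h'⟩ := h q hq
      · obtain ⟨t, ht, i, hi, he⟩ := h' r le_rfl
        exact ⟨t, hr.trans ht, Sum.inl i, hi, he⟩
      · exact ⟨r, hr, Sum.inr r, le_rfl, h'⟩

theorem ForcesEq.succ {x y : PName P} {p : P} (h : ForcesEq x y p) :
    ForcesEq (succ x) (succ y) p := by
  refine ForcesEq.ext fun z q hq => ?_
  rw [forcesMem_succ, forcesMem_succ]
  refine forall₂_congr fun s hs => exists_congr fun r => and_congr_right fun hr => ?_
  have h' := h.mono ((hq.trans hs).trans hr)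
  exact or_congr ⟨fun k => k.congr_right h', fun k => k.congr_right h'.symm⟩
    ⟨fun k => k.trans h', fun k => k.trans h'.symm⟩

/-- The canonical name of the natural number `n`. -/
def nat : ℕ → PName P
  | 0 => ofFamily fun i : PEmpty => i.elim
  | n + 1 => succ (nat n)

theorem not_forcesMem_nat_zero (x : PName P) (p : P) : ¬ ForcesMem x (nat 0) p := fun h => by
  obtain ⟨_, _, i, _⟩ := forcesMem_ofFamily.1 h p le_rfl
  exact i.elim

theorem forcesMem_nat {n : ℕ} {x : PName P} {p : P} :
    ForcesMem x (nat n) p ↔ ∀ q, p ≤ q → ∃ r, q ≤ r ∧ ∃ m < n, ForcesEq x (nat m) r := by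
  induction n generalizing p with
  | zero =>
    refine ⟨fun h => (not_forcesMem_nat_zero x p h).elim, fun h => ?_⟩
    obtain ⟨_, _, m, hm, _⟩ := h p le_rfl
    exact (Nat.not_lt_zero m hm).elim
  | succ n ih =>
    rw [nat, forcesMem_succ]
    refine ⟨fun h q hq => ?_, fun h q hq => ?_⟩
    · obtain ⟨r, hr, h' | h'⟩ := h q hq
      · obtain ⟨t, ht, m, hm, he⟩ := ih.1 h' r le_rfl
        exact ⟨t, hr.trans ht, m, hm.trans n.lt_succ_self, he⟩
      · exact ⟨r, hr, n, n.lt_succ_self, h'⟩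
    · obtain ⟨r, hr, m, hm, he⟩ := h q hq
      refine ⟨r, hr, ?_⟩
      rcases Nat.lt_succ_iff_lt_or_eq.1 hm with hm | rfl
      · exact Or.inl (ih.2 fun s hs => ⟨s, le_rfl, m, hm, he.mono hs⟩)
      · exact Or.inr he

theorem forcesMem_nat_nat {m n : ℕ} (h : m < n) (p : P) :
    ForcesMem (nat m : PName P) (nat n) p :=
  forcesMem_nat.2 fun q _ => ⟨q, le_rfl, m, h, ForcesEq.refl _ _⟩

theorem ForcesEq.nat_inj {m n : ℕ} {p : P} (h : ForcesEq (nat m : PName P) (nat n) p) :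
    m = n := by
  rcases lt_trichotomy m n with hlt | heq | hlt
  · exact (not_forcesMem_self _ p ((forcesMem_nat_nat hlt p).congr_right h.symm)).elim
  · exact heq
  · exact (not_forcesMem_self _ p ((forcesMem_nat_nat hlt p).congr_right h)).elim

theorem ForcesMem.nat_lt {m n : ℕ} {p : P} (h : ForcesMem (nat m : PName P) (nat n) p) :
    m < n := by
  obtain ⟨_, _, k, hk, he⟩ := forcesMem_nat.1 h p le_rfl
  exact he.nat_inj ▸ hk

/-- The canonical name of `ω`. -/
def omega : PName P := ofFamily fun n : ULift.{u} ℕ => nat n.down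

theorem forcesMem_omega {x : PName P} {p : P} :
    ForcesMem x omega p ↔ ∀ q, p ≤ q → ∃ r, q ≤ r ∧ ∃ n, ForcesEq x (nat n) r := by
  rw [omega, forcesMem_ofFamily]
  simp only [ULift.exists]

theorem forcesMem_nat_omega (n : ℕ) (p : P) : ForcesMem (nat n : PName P) omega p :=
  forcesMem_omega.2 fun q _ => ⟨q, le_rfl, n, ForcesEq.refl _ _⟩

/-- The canonical name of the sequence of the `x n`. -/
def seq (x : ℕ → PName P) : PName P := ofFamily fun n : ULift.{u} ℕ => pair (nat n.down) (x n.down)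

theorem forcesMem_seq {x : ℕ → PName P} {y : PName P} {p : P} :
    ForcesMem y (seq x) p ↔
      ∀ q, p ≤ q → ∃ r, q ≤ r ∧ ∃ n, ForcesEq y (pair (nat n) (x n)) r := by
  rw [seq, forcesMem_ofFamily]
  simp only [ULift.exists]

theorem forcesMem_pair_seq {x : ℕ → PName P} {a b : PName P} {p : P} :
    ForcesMem (pair a b) (seq x) p ↔
      ∀ q, p ≤ q → ∃ r, q ≤ r ∧ ∃ n, ForcesEq a (nat n) r ∧ ForcesEq b (x n) r := by
  rw [forcesMem_seq]
  exact forall₂_congr fun q _ => exists_congr fun r => and_congr_right fun _ =>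
    exists_congr fun n => ⟨fun h => ⟨h.of_pair_left, h.of_pair_right⟩, fun h => h.1.pair h.2⟩

end PName

/-! ### Evaluating formulas under the forcing relation. -/

open PName

theorem Forces.of_dense {P : Type u} [Preorder P] {φ : SetFormula (PName P)} {p : P}
    (h : ∀ q, p ≤ q → ∃ r, q ≤ r ∧ Forces φ r) : Forces φ p := by
  induction φ generalizing p with
  | mem x y => exact ForcesMem.of_dense h
  | eq x y => exact ForcesEq.of_dense h
  | neg φ _ =>
    intro q hq hφ
    obtain ⟨r, hr, hn⟩ := h q hq
    exact hn r le_rfl (hφ.mono hr)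
  | and φ ψ h₁ h₂ =>
    exact ⟨h₁ fun q hq => (h q hq).imp fun _ hr => ⟨hr.1, hr.2.1⟩,
      h₂ fun q hq => (h q hq).imp fun _ hr => ⟨hr.1, hr.2.2⟩⟩
  | or φ ψ _ _ =>
    intro q hq
    obtain ⟨r, hr, hφ⟩ := h q hq
    obtain ⟨t, ht, h'⟩ := hφ r le_rfl
    exact ⟨t, hr.trans ht, h'⟩
  | imp φ ψ _ h₂ =>
    intro q hq hφ
    refine h₂ fun s hs => ?_
    obtain ⟨r, hr, hi⟩ := h s (hq.trans hs)
    exact ⟨r, hr, hi r le_rfl (hφ.mono (hs.trans hr))⟩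
  | all φ ih => exact fun x => ih x fun q hq => (h q hq).imp fun _ hr => ⟨hr.1, hr.2 x⟩
  | ex φ _ =>
    intro q hq
    obtain ⟨r, hr, hφ⟩ := h q hq
    obtain ⟨t, ht, h'⟩ := hφ r le_rfl
    exact ⟨t, hr.trans ht, h'⟩

namespace SetFormula

variable {P : Type u} [Preorder P]

theorem forces_iff {φ ψ : SetFormula (PName P)} {p : P} :
    Forces (φ.iff ψ) p ↔ ∀ q, p ≤ q → (Forces φ q ↔ Forces ψ q) :=
  ⟨fun h q hq => ⟨h.1 q hq, h.2 q hq⟩, fun h => ⟨fun q hq => (h q hq).1, fun q hq => (h q hq).2⟩⟩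

theorem forces_isUPair {z a b : PName P} {p : P} :
    Forces (isUPair z a b) p ↔ ForcesEq z (upair a b) p := by
  have key : ∀ x q, Forces ((eq x a).or (eq x b)) q ↔ ForcesMem x (upair a b) q :=
    fun x q => forcesMem_upair.symm
  refine ⟨fun h => ForcesEq.ext fun x q hq => (forces_iff.1 (h x) q hq).trans (key x q),
    fun h x => forces_iff.2 fun q hq => Iff.trans ?_ (key x q).symm⟩
  exact ⟨fun k => k.congr_right (h.mono hq), fun k => k.congr_right (h.mono hq).symm⟩

theorem forces_isPair {z a b : PName P} {p : P} :
    Forces (isPair z a b) p ↔ ForcesEq z (pair a b) p := by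
  have key : ∀ x q, Forces ((isUPair x a a).or (isUPair x a b)) q ↔ ForcesMem x (pair a b) q :=
    fun x q => by
      rw [pair, forcesMem_upair]
      exact forall₂_congr fun s _ => exists_congr fun r => and_congr_right fun _ =>
        or_congr forces_isUPair forces_isUPair
  refine ⟨fun h => ForcesEq.ext fun x q hq => (forces_iff.1 (h x) q hq).trans (key x q),
    fun h x => forces_iff.2 fun q hq => Iff.trans ?_ (key x q).symm⟩
  exact ⟨fun k => k.congr_right (h.mono hq), fun k => k.congr_right (h.mono hq).symm⟩

/-- The quantifier over pairs is witnessed by the canonical pair, so statements about `rel` reduce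
to membership. -/
theorem forces_rel {r a b : PName P} {p : P} :
    Forces (rel r a b) p ↔ ForcesMem (pair a b) r p := by
  refine ⟨fun h => ForcesMem.of_dense fun q hq => ?_, fun h q hq => ?_⟩
  · obtain ⟨s, hs, z, h₁, h₂⟩ := h q hq
    exact ⟨s, hs, ForcesMem.congr_left h₂ (forces_isPair.1 h₁)⟩
  · exact ⟨q, le_rfl, pair a b, forces_isPair.2 (ForcesEq.refl _ _), h.mono hq⟩

theorem forces_rel_congr {r a b a' b' : PName P} {p : P} (h : Forces (rel r a b) p)
    (ha : ForcesEq a a' p) (hb : ForcesEq b b' p) : Forces (rel r a' b') p :=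
  forces_rel.2 ((forces_rel.1 h).congr_left (ha.pair hb))

theorem forces_isInductive_omega (p : P) : Forces (isInductive (omega : PName P)) p := by
  refine ⟨fun q _ => ⟨q, le_rfl, nat 0, forcesMem_nat_omega 0 q, fun x r _ =>
    not_forcesMem_nat_zero x r⟩, fun n q _ hn s hs => ?_⟩
  obtain ⟨r, hr, k, hk⟩ := forcesMem_omega.1 hn s hs
  refine ⟨r, hr, succ n, (forcesMem_nat_omega (k + 1) r).congr_left hk.succ.symm, fun x => ?_⟩
  exact forces_iff.2 fun t _ => forcesMem_succ

theorem forcesMem_nat_of_isInductive {I : PName P} {p : P} (h : Forces (isInductive I) p)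
    (n : ℕ) : ForcesMem (nat n) I p := by
  induction n with
  | zero =>
    refine ForcesMem.of_dense fun q hq => ?_
    obtain ⟨r, hr, z, hz, he⟩ := h.1 q hq
    refine ⟨r, hr, ForcesMem.congr_left hz (ForcesEq.ext fun x s hs => ?_)⟩
    exact ⟨fun k => (he x s hs k).elim, fun k => (not_forcesMem_nat_zero x s k).elim⟩
  | succ n ih =>
    refine ForcesMem.of_dense fun q hq => ?_
    obtain ⟨r, hr, m, hm, he⟩ := h.2 (nat n) p le_rfl ih q hq
    refine ⟨r, hr, ForcesMem.congr_left hm (ForcesEq.ext fun x s hs => ?_)⟩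
    exact (forces_iff.1 (he x) s hs).trans forcesMem_succ.symm

theorem forces_isOmega_omega (p : P) : Forces (isOmega (omega : PName P)) p := by
  refine ⟨forces_isInductive_omega p, fun I q _ hI n r hr hn => ForcesMem.of_dense fun s hs => ?_⟩
  obtain ⟨t, ht, k, hk⟩ := forcesMem_omega.1 hn s hs
  exact ⟨t, ht, (forcesMem_nat_of_isInductive
    (hI.mono ((hr.trans hs).trans ht)) k).congr_left hk.symm⟩

theorem forces_isFunctionOn_seq (x : ℕ → PName P) (p : P) :
    Forces (isFunctionOn (seq x) omega) p := by
  refine ⟨fun z q _ hz s hs => ?_, fun n q _ hn s hs => ?_, fun n q _ hn a b q' _ ha q'' hq'' hb =>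
    ForcesEq.of_dense fun s hs => ?_⟩
  · obtain ⟨r, hr, k, hk⟩ := forcesMem_seq.1 hz s hs
    exact ⟨r, hr, nat k, forcesMem_nat_omega k r, fun t ht => ⟨t, le_rfl, x k,
      forces_isPair.2 (hk.mono ht)⟩⟩
  · obtain ⟨r, hr, k, hk⟩ := forcesMem_omega.1 hn s hs
    exact ⟨r, hr, x k, forces_rel.2 (forcesMem_pair_seq.2 fun t ht => ⟨t, le_rfl, k, hk.mono ht,
      ForcesEq.refl _ _⟩)⟩
  · obtain ⟨r, hr, k, hk, hka⟩ := forcesMem_pair_seq.1 (forces_rel.1 ha) s (hq''.trans hs)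
    obtain ⟨t, ht, l, hl, hlb⟩ := forcesMem_pair_seq.1 (forces_rel.1 hb) r (hs.trans hr)
    obtain rfl := ((hk.mono ht).symm.trans hl).nat_inj
    exact ⟨t, hr.trans ht, (hka.mono ht).trans hlb.symm⟩

end SetFormula

/-! ### Iterable sweetness in terms of forcing. -/

section

variable {P : Type u} [Preorder P]

namespace ForcingName

variable (Q : ForcingName P)

/-- `p ⊩ x ≤ y` -/
def Le (x y : PName P) (p : P) : Prop := Forces (SetFormula.rel Q.le x y) p

variable {Q} {x y z : PName P} {p q : P}

theorem Le.mono (h : Q.Le x y p) (hpq : p ≤ q) : Q.Le x y q := Forces.mono h hpq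

theorem Le.of_dense (h : ∀ q, p ≤ q → ∃ r, q ≤ r ∧ Q.Le x y r) : Q.Le x y p := Forces.of_dense h

theorem Le.congr {x' y' : PName P} (h : Q.Le x y p) (hx : ForcesEq x x' p)
    (hy : ForcesEq y y' p) : Q.Le x' y' p := SetFormula.forces_rel_congr h hx hy

theorem le_refl (hx : ForcesMem x Q.carrier p) : Q.Le x x p := (Q.forced p).1 x p le_rfl hx

theorem Le.trans (h : Q.Le x y p) (h' : Q.Le y z p) (hx : ForcesMem x Q.carrier p)
    (hy : ForcesMem y Q.carrier p) (hz : ForcesMem z Q.carrier p) : Q.Le x z p :=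
  (Q.forced p).2.1 x p le_rfl hx y p le_rfl hy z p le_rfl hz p le_rfl h p le_rfl h'

theorem weakest_mem (p : P) : ForcesMem Q.weakest Q.carrier p := (Q.forced p).2.2.1

theorem weakest_le (hx : ForcesMem x Q.carrier p) : Q.Le Q.weakest x p :=
  (Q.forced p).2.2.2.1 x p le_rfl hx

theorem Le.eq_weakest (h : Q.Le x Q.weakest p) (hx : ForcesMem x Q.carrier p) :
    ForcesEq x Q.weakest p :=
  (Q.forced p).2.2.2.2 x p le_rfl hx p le_rfl h

/-- What it means for the generic extension that `(Q, B)` is forced to be a model of iterable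
sweetness. -/
structure IsIterablySweet (Q : ForcingName P) (B : PName P) : Prop where
  mem_carrier : ∀ {U x : PName P} {p : P}, ForcesMem U B p → ForcesMem x U p →
    ForcesMem x Q.carrier p
  exists_mem : ∀ {x : PName P} {p : P}, ForcesMem x Q.carrier p →
    ∃ r, p ≤ r ∧ ∃ U, ForcesMem U B r ∧ ForcesMem x U r
  exists_inter : ∀ {U V : PName P} {p : P}, ForcesMem U B p → ForcesMem V B p →
    ∃ r, p ≤ r ∧ ∃ W, ForcesMem W B r ∧
      ∀ x s, r ≤ s → (ForcesMem x W s ↔ ForcesMem x U s ∧ ForcesMem x V s)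
  directed : ∀ {U x y : PName P} {p : P}, ForcesMem U B p → ForcesMem x U p → ForcesMem y U p →
    ∃ r, p ≤ r ∧ ∃ z, ForcesMem z U r ∧ Q.Le x z r ∧ Q.Le y z r
  mem_of_le : ∀ {U x y : PName P} {p : P}, ForcesMem U B p → ForcesMem x Q.carrier p →
    ForcesMem y U p → Q.Le x y p → ForcesMem x U p
  exists_bound : ∀ {U x : PName P} {s : ℕ → PName P} {p : P}, ForcesMem U B p →
    (∀ n, ForcesMem (s n) U p) → ForcesMem x U p →
    (∀ V q, p ≤ q → ForcesMem V B q → ForcesMem x V q →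
      ∃ r, q ≤ r ∧ ∀ᶠ n in atTop, ForcesMem (s n) V r) →
    ∃ r, p ≤ r ∧ ∃ z, ForcesMem z U r ∧ (∀ n, Q.Le (s n) z r) ∧ Q.Le x z r
  countable : ∀ p, ∃ r, p ≤ r ∧ ∃ f,
    (∀ U q, r ≤ q → ForcesMem U B q →
      ∃ t, q ≤ t ∧ ∃ n, Forces (SetFormula.rel f (nat n) U) t) ∧
    ∀ n U V q, r ≤ q → Forces (SetFormula.rel f (nat n) U) q →
      Forces (SetFormula.rel f (nat n) V) q → ForcesEq U V q

/-- The internal quantifiers over `ω` and over sequences are instantiated with `omega` and `seq s`,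
whose elements are densely equal to canonical ones; this turns them into statements about natural
numbers and sequences of names. -/
theorem isIterablySweet_of_forced {B : PName P}
    (h : Forced (SetFormula.isIterableSweetnessModel Q.carrier Q.le B)) :
    Q.IsIterablySweet B where
  mem_carrier {U x p} hU hx := (h p).1.1 U p le_rfl hU x p le_rfl hx
  exists_mem {x p} hx := (h p).1.2.1 x p le_rfl hx p le_rfl
  exists_inter {U V p} hU hV := by
    obtain ⟨r, hr, W, hW, he⟩ := (h p).2.2.1 U p le_rfl hU V p le_rfl hV p le_rfl
    exact ⟨r, hr, W, hW, fun x s hs => SetFormula.forces_iff.1 (he x) s hs⟩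
  directed {U x y p} hU hx hy :=
    ((h p).2.2.2.1 U p le_rfl hU).1 x p le_rfl hx y p le_rfl hy p le_rfl
  mem_of_le {U x y p} hU hx hy hxy :=
    ((h p).2.2.2.1 U p le_rfl hU).2 x p le_rfl hx y p le_rfl hy p le_rfl hxy
  exists_bound {U x s p} hU hs hx hc := by
    obtain ⟨r, hr, z, hz, hb, hxz⟩ := (h p).2.2.2.2 omega p le_rfl
      (SetFormula.forces_isOmega_omega p) U p le_rfl hU (seq s) p le_rfl
      (SetFormula.forces_isFunctionOn_seq s p) p le_rfl
      (fun n q _ _ y r hr hy => by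
        refine ForcesMem.of_dense fun t ht => ?_
        obtain ⟨e, he, k, -, hk⟩ := forcesMem_pair_seq.1 (SetFormula.forces_rel.1 hy) t ht
        exact ⟨e, he, ((hs k).mono (by order)).congr_left hk.symm⟩)
      x p le_rfl hx p le_rfl
      (fun V q hq hV q' hq' hxV r hr => by
        obtain ⟨t, ht, hN⟩ := hc V r (by order) (hV.mono (by order)) (hxV.mono hr)
        obtain ⟨N, hN⟩ := eventually_atTop.1 hN
        refine ⟨t, ht, nat N, forcesMem_nat_omega N t, fun n a ha hn b hb hNn y c hc hy => ?_⟩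
        refine ForcesMem.of_dense fun d hd => ?_
        obtain ⟨e, he, k, hnk, hk⟩ := forcesMem_pair_seq.1 (SetFormula.forces_rel.1 hy) d hd
        have hlt : N < k := ((ForcesMem.mono hNn (by order : b ≤ e)).congr_right hnk).nat_lt
        exact ⟨e, he, ((hN k hlt.le).mono (by order)).congr_left hk.symm⟩) p le_rfl
    refine ⟨r, hr, z, hz, fun n => ?_, hxz⟩
    exact hb (nat n) r le_rfl (forcesMem_nat_omega n r) (s n) r le_rfl
      (SetFormula.forces_rel.2 (forcesMem_pair_seq.2 fun t _ =>
        ⟨t, le_rfl, n, ForcesEq.refl _ _, ForcesEq.refl _ _⟩))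
  countable p := by
    obtain ⟨r, hr, o, r', hr', f, ho, hf, hB⟩ :
      ∃ r, p ≤ r ∧ ∃ o : PName P, ∃ r', r ≤ r' ∧ ∃ f : PName P,
        Forces (SetFormula.isOmega o) r' ∧ Forces (SetFormula.isFunctionOn f o) r' ∧
        Forces (SetFormula.allIn B fun U => SetFormula.exIn o fun n => SetFormula.rel f n U) r' := by
      obtain ⟨r, hr, o, h'⟩ := (h p).2.1 p le_rfl
      obtain ⟨r', hr', f, h''⟩ := h' r le_rfl
      exact ⟨r, hr, o, r', hr', f, h''⟩
    refine ⟨r', hr.trans hr', f, fun U q hq hU => ?_, fun n U V q hq hU hV => ?_⟩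
    · obtain ⟨t, ht, n, hn, hnU⟩ := hB U q hq hU q le_rfl
      -- Minimality of `o` among inductive sets puts `n` in `omega`, so above some condition it is a
      -- standard number.
      have hn' := ho.2 omega t (hq.trans ht) (SetFormula.forces_isInductive_omega t) n t le_rfl hn
      obtain ⟨e, he, k, hk⟩ := forcesMem_omega.1 hn' t le_rfl
      exact ⟨e, ht.trans he, k,
        SetFormula.forces_rel_congr (Forces.mono hnU he) hk (ForcesEq.refl _ _)⟩
    · exact hf.2.2 (nat n) q hq (SetFormula.forcesMem_nat_of_isInductive (ho.1.mono hq) n)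
        U V q le_rfl hU q le_rfl hV

/-- Finitely many elements of `B` have an intersection in `B`. -/
theorem IsIterablySweet.exists_finite_inter {B : PName P} (hB : Q.IsIterablySweet B)
    {ι : Type*} {T : Set ι} (hT : T.Finite) (V : ι → PName P) {U : PName P} {p : P}
    (hU : ForcesMem U B p) (hV : ∀ i ∈ T, ForcesMem (V i) B p) :
    ∃ r, p ≤ r ∧ ∃ W, ForcesMem W B r ∧ ∀ x s, r ≤ s →
      (ForcesMem x W s ↔ ForcesMem x U s ∧ ∀ i ∈ T, ForcesMem x (V i) s) := by
  induction T, hT using Set.Finite.induction_on with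
  | empty => exact ⟨p, le_rfl, U, hU, by simp⟩
  | @insert i T _ _ ih =>
    obtain ⟨r, hr, W, hW, h⟩ := ih fun j hj => hV j (Set.mem_insert_of_mem _ hj)
    obtain ⟨r', hr', W', hW', h'⟩ := hB.exists_inter hW ((hV i (Set.mem_insert _ _)).mono hr)
    refine ⟨r', hr.trans hr', W', hW', fun x s hs => ?_⟩
    rw [h' x s hs, h x s (hr'.trans hs), Set.forall_mem_insert]
    tauto

end ForcingName

/-! ### Antichains, mixing of names and representatives. -/

/-- A dense set of conditions contains a maximal antichain. -/
theorem exists_antichain_of_dense {D : Set P} (hD : ∀ p, ∃ q ∈ D, p ≤ q) :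
    ∃ A ⊆ D, A.Pairwise (fun p q => ¬ Compatible p q) ∧ ∀ p, ∃ a ∈ A, Compatible p a := by
  obtain ⟨A, hA⟩ := zorn_subset {A : Set P | A ⊆ D ∧ A.Pairwise fun p q => ¬ Compatible p q}
    fun C hC hchain => ⟨⋃₀ C, ⟨Set.sUnion_subset fun A hA => (hC hA).1,
      (Set.pairwise_sUnion hchain.directedOn).2 fun A hA => (hC hA).2⟩,
      fun A hA => Set.subset_sUnion_of_mem hA⟩
  refine ⟨A, hA.prop.1, hA.prop.2, fun p => ?_⟩
  by_contra! hp
  obtain ⟨q, hq, hpq⟩ := hD p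
  have hq' : ∀ a ∈ A, ¬ Compatible q a := fun a ha ⟨r, hqr, har⟩ => hp a ha ⟨r, hpq.trans hqr, har⟩
  have hins : insert q A ⊆ A := hA.le_of_ge
    ⟨Set.insert_subset hq hA.prop.1, hA.prop.2.insert fun a ha _ =>
      ⟨hq' a ha, fun ⟨r, h₁, h₂⟩ => hq' a ha ⟨r, h₂, h₁⟩⟩⟩ (Set.subset_insert q A)
  exact hq' q (hins (Set.mem_insert q A)) ⟨q, le_rfl, le_rfl⟩

namespace PName

/-- The name that is equal to `u a` if the element `a` of an antichain is in the generic filter. -/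
def mix (A : Set P) (ι : A → Type u) (v : ∀ a, ι a → PName P) (s : ∀ a, ι a → P) : PName P :=
  mk (Σ a : A, Σ i : ι a, {c : P // a.1 ≤ c ∧ s a i ≤ c}) (fun x => v x.1 x.2.1)
    (fun x => x.2.2.1)

theorem forcesEq_mix {A : Set P} (hA : A.Pairwise fun p q => ¬ Compatible p q)
    (ι : A → Type u) (v : ∀ a, ι a → PName P) (s : ∀ a, ι a → P) (a : A) :
    ForcesEq (mix A ι v s) (mk (ι a) (v a) (s a)) a.1 := by
  refine ⟨?_, fun i q hq hs => ⟨q, le_rfl, ⟨a, i, q, hq, hs⟩, le_rfl, ForcesEq.refl _ _⟩⟩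
  rintro ⟨a', i, c, hac, hsc⟩ q hq (hc : c ≤ q)
  -- A pair contributed by `a'` is active only above `a'`; being active above `a` as well makes the
  -- two elements of the antichain compatible.
  obtain rfl : a' = a := Subtype.ext (hA.eq a'.2 a.2 (not_not.2 ⟨q, hac.trans hc, hq⟩))
  exact ⟨q, le_rfl, i, hsc.trans hc, ForcesEq.refl _ _⟩

theorem exists_mix {A : Set P} (hA : A.Pairwise fun p q => ¬ Compatible p q) (u : P → PName P) :
    ∃ x, ∀ a ∈ A, ForcesEq x (u a) a := by
  have h : ∀ a : A, ∃ (ι : Type u) (v : ι → PName P) (s : ι → P), u a.1 = mk ι v s := fun a => by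
    cases u a.1 with
    | mk ι v s => exact ⟨ι, v, s, rfl⟩
  choose ι v s h using h
  exact ⟨mix A ι v s, fun a ha => by
    simpa [h ⟨a, ha⟩] using forcesEq_mix hA ι v s ⟨a, ha⟩⟩

/-- If densely many conditions `p` have a witness `x` for `Φ x p`, then there is one name which is
equal to witnesses densely often. -/
theorem exists_forall_dense {Φ : PName P → P → Prop} (hΦ : ∀ p, ∃ q, p ≤ q ∧ ∃ x, Φ x q) :
    ∃ x, ∀ p, ∃ r, p ≤ r ∧ ∃ q ≤ r, ∃ y, Φ y q ∧ ForcesEq x y r := by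
  obtain ⟨A, hAD, hA, hmax⟩ := exists_antichain_of_dense (D := {q | ∃ x, Φ x q})
    fun p => (hΦ p).imp fun q hq => ⟨hq.2, hq.1⟩
  have h : ∀ a, ∃ y, a ∈ A → Φ y a := fun a => by
    by_cases ha : a ∈ A
    · exact (hAD ha).imp fun y hy _ => hy
    · exact ⟨nat 0, fun h => (ha h).elim⟩
  choose u hu using h
  obtain ⟨x, hx⟩ := exists_mix hA u
  refine ⟨x, fun p => ?_⟩
  obtain ⟨a, ha, r, hpr, har⟩ := hmax p
  exact ⟨r, hpr, a, har, u a, hu a ha, (hx a ha).mono har⟩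

/-- Up to equality, the elements of a name are given by a small set of names. -/
theorem exists_small_representatives (y w : PName P) (hw : Forced (SetFormula.mem w y)) :
    ∃ N : Set (PName P), Small.{u} N ∧
      ∀ x, Forced (SetFormula.mem x y) → ∃ x' ∈ N, ∀ p, ForcesEq x x' p := by
  classical
  cases y with
  | mk ι v s =>
    -- Names forced into `y` densely agree with some `v i`, so equal codes force equality; codes are
    -- subsets of `P × ι` and hence form a small family.
    let code : PName P → Set (P × ι) := fun x => {i | ForcesEq x (v i.2) i.1}
    let rep : Set (P × ι) → PName P := fun S =>
      if h : ∃ x, Forced (SetFormula.mem x (mk ι v s)) ∧ code x = S then h.choose else w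
    refine ⟨Set.range rep, inferInstance, fun x hx => ⟨rep (code x), ⟨_, rfl⟩, fun p => ?_⟩⟩
    have h : ∃ x', Forced (SetFormula.mem x' (mk ι v s)) ∧ code x' = code x := ⟨x, hx, rfl⟩
    have hrep : rep (code x) = h.choose := dif_pos h
    rw [hrep]
    refine ForcesEq.of_dense fun q _ => ?_
    obtain ⟨r, hr, i, -, he⟩ := hx q q le_rfl
    have hmem : (r, i) ∈ code h.choose := by
      rw [h.choose_spec.2]
      exact he
    exact ⟨r, hr, he.trans (ForcesEq.symm hmem)⟩

end PName

end

/-! ### Countability consequences of topological sweetness. -/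

section

variable {P : Type u} [Preorder P] {τ : TopologicalSpace P}

namespace IsTopologicalSweetnessModel

/-- Sweetness applied to the subsequence enumerating `M`; this allows infinite index sets to be
thinned out repeatedly. -/
theorem exists_bound_of_infinite (hP : IsTopologicalSweetnessModel P τ) {s : ℕ → P} {p q : P}
    {W : Set P} {M : Set ℕ} (hs : Tendsto s atTop (𝓝 p)) (hpq : p ≤ q) (hW : W ∈ 𝓝 q)
    (hM : M.Infinite) : ∃ r ∈ W, q ≤ r ∧ (M ∩ {n | s n ≤ r}).Infinite := by
  have hmono := Nat.nth_strictMono hM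
  obtain ⟨r, hr, hqr, hinf⟩ := hP.sweet (s ∘ Nat.nth (· ∈ M)) p q W
    (hs.comp hmono.tendsto_atTop) hpq hW
  refine ⟨r, hr, hqr, (hinf.image hmono.injective.injOn).mono ?_⟩
  rintro _ ⟨n, hn, rfl⟩
  exact ⟨Nat.nth_mem_of_infinite hM n, hn⟩

/-- Every set of conditions has a countable subset which is predense in it. -/
theorem exists_countable_predense (hP : IsTopologicalSweetnessModel P τ) (T : Set P) :
    ∃ A ⊆ T, A.Countable ∧ ∀ t ∈ T, ∃ a ∈ A, Compatible t a := by
  have := hP.secondCountable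
  obtain ⟨D, hDc, hD⟩ := TopologicalSpace.exists_countable_dense T
  refine ⟨Subtype.val '' D, by simp, hDc.image _, fun t ht => ?_⟩
  -- A sequence of `D` converges to `t`, and sweetness with `p = q = t` yields a condition above
  -- both `t` and some term.
  obtain ⟨d, hdD, hd⟩ := mem_closure_iff_seq_limit.1 (hD ⟨t, ht⟩)
  obtain ⟨r, -, htr, hinf⟩ := hP.sweet (fun n => (d n : P)) t t Set.univ
    ((continuous_subtype_val.tendsto (⟨t, ht⟩ : T)).comp hd) le_rfl univ_mem
  obtain ⟨n, hn⟩ := hinf.nonempty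
  exact ⟨d n, ⟨d n, hdD n, rfl⟩, r, htr, hn⟩

/-- A name which is forced to be a countable set has countably many elements, up to equality. -/
theorem exists_countable_cover (hP : IsTopologicalSweetnessModel P τ) {Q : ForcingName P}
    {B : PName P} (hB : Q.IsIterablySweet B) :
    ∃ S : Set (P × PName P), S.Countable ∧ (∀ j ∈ S, ForcesMem j.2 B j.1) ∧
      ∀ V p, ForcesMem V B p → ∃ r, p ≤ r ∧ ∃ j ∈ S, j.1 ≤ r ∧ ForcesEq V j.2 r := by
  let Good : PName P → P → Prop := fun f r =>
    (∀ U q, r ≤ q → ForcesMem U B q → ∃ t, q ≤ t ∧ ∃ n, Forces (SetFormula.rel f (nat n) U) t) ∧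
    ∀ n U V q, r ≤ q → Forces (SetFormula.rel f (nat n) U) q →
      Forces (SetFormula.rel f (nat n) V) q → ForcesEq U V q
  -- Two countable choices: conditions fixing an enumeration of `B`, then for each of them and each
  -- `n` conditions fixing the `n`-th value.
  obtain ⟨A, hAT, hAc, hA⟩ := hP.exists_countable_predense {r | ∃ f, Good f r}
  have h₁ : ∀ a, ∃ f, a ∈ A → Good f a := fun a => by
    by_cases ha : a ∈ A
    · exact (hAT ha).imp fun _ h _ => h
    · exact ⟨nat 0, fun h => (ha h).elim⟩
  choose f hf using h₁
  let Val : P → ℕ → PName P → P → Prop := fun a n U r =>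
    a ≤ r ∧ ForcesMem U B r ∧ Forces (SetFormula.rel (f a) (nat n) U) r
  choose A' hAT' hAc' hA' using fun (a : P) (n : ℕ) =>
    hP.exists_countable_predense {r | ∃ U, Val a n U r}
  have h₂ : ∀ a n r, ∃ U, r ∈ A' a n → Val a n U r := fun a n r => by
    by_cases hr : r ∈ A' a n
    · exact (hAT' a n hr).imp fun _ h _ => h
    · exact ⟨nat 0, fun h => (hr h).elim⟩
  choose U hU using h₂
  refine ⟨⋃ a ∈ A, ⋃ n, (fun r => (r, U a n r)) '' A' a n,
    hAc.biUnion fun a _ => Set.countable_iUnion fun n => (hAc' a n).image _, ?_, ?_⟩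
  · simp only [Set.mem_iUnion]
    rintro _ ⟨a, ha, n, r, hr, rfl⟩
    exact (hU a n r hr).2.1
  · intro V p hV
    obtain ⟨r, hr, hrT⟩ := hB.countable p
    obtain ⟨a, ha, t, hrt, hat⟩ := hA r hrT
    obtain ⟨e, hte, n, hn⟩ := (hf a ha).1 V t hat (hV.mono (hr.trans hrt))
    obtain ⟨b, hb, d, hed, hbd⟩ := hA' a n e ⟨V, hat.trans hte,
      hV.mono ((hr.trans hrt).trans hte), hn⟩
    refine ⟨d, hr.trans (hrt.trans (hte.trans hed)), (b, U a n b), ?_, hbd, ?_⟩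
    · simp only [Set.mem_iUnion]
      exact ⟨a, ha, n, b, hb, rfl⟩
    · exact (hf a ha).2 n V _ d (hat.trans (hte.trans hed)) (hn.mono hed)
        ((hU a n b hb).2.2.mono hbd)

end IsTopologicalSweetnessModel

end

/-! ### Diagonalisation and convergent choices. -/

section

/-- A diagonalisation: if every infinite set of natural numbers has an infinite subset with the
property `E i`, for each of countably many `i`, then some sequence is eventually contained in a
set with the property `E i`, for all `i`. -/
theorem exists_strictMono_forall_eventually_mem {ι : Type*} [Countable ι]
    {E : ι → Set ℕ → Prop} (h : ∀ i X, X.Infinite → ∃ Y ⊆ X, Y.Infinite ∧ E i Y) :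
    ∃ φ : ℕ → ℕ, StrictMono φ ∧ ∀ i, ∃ Y, E i Y ∧ ∀ᶠ n in atTop, φ n ∈ Y := by
  rcases isEmpty_or_nonempty ι with _ | _
  · exact ⟨id, strictMono_id, isEmptyElim⟩
  obtain ⟨e, he⟩ := exists_surjective_nat ι
  choose F hF hFinf hFE using h
  let X : ℕ → {X : Set ℕ // X.Infinite} := fun n => Nat.rec ⟨Set.univ, Set.infinite_univ⟩
    (fun n X => ⟨F (e n) X.1 X.2, hFinf (e n) X.1 X.2⟩) n
  have hanti : Antitone fun n => (X n).1 := antitone_nat_of_succ_le fun n => hF _ _ _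
  obtain ⟨φ, hφ, hφX⟩ := extraction_forall_of_frequently (P := fun n k => k ∈ (X n).1)
    fun n => Nat.frequently_atTop_iff_infinite.2 (X n).2
  refine ⟨φ, hφ, fun i => ?_⟩
  obtain ⟨n, rfl⟩ := he i
  -- Stage `n + 1` secures the property of index `e n`, and later stages are subsets of it.
  exact ⟨(X (n + 1)).1, hFE _ _ _, eventually_atTop.2 ⟨n + 1, fun m hm => hanti hm (hφX m)⟩⟩

/-- This manufactures the convergent sequences to which sweetness is applied: points chosen from the
sets `V n` converge automatically. -/
theorem TopologicalSpace.IsTopologicalBasis.exists_seq {X : Type*} [TopologicalSpace X]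
    [FirstCountableTopology X] {𝒱 : Set (Set X)} (h𝒱 : IsTopologicalBasis 𝒱) (x : X) :
    ∃ V : ℕ → Set X, (∀ n, V n ∈ 𝒱 ∧ x ∈ V n) ∧
      ∀ a : ℕ → X, (∀ n, a n ∈ V n) → Tendsto a atTop (𝓝 x) := by
  obtain ⟨W, hW⟩ := (𝓝 x).exists_antitone_basis
  choose V hV hxV hVW using fun n => h𝒱.mem_nhds_iff.1 (hW.mem n)
  exact ⟨V, fun n => ⟨hV n, hxV n⟩, fun a ha => hW.tendsto fun n => hVW n (ha n)⟩

/-! ### Bounding a convergent sequence of names. -/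

variable {P : Type u} [Preorder P]

/-- Above such an `r` it is settled which elements of `T` belong to the generic filter. -/
theorem exists_le_and_forall_decided {T : Set P} (hT : T.Finite) (p : P) :
    ∃ r, p ≤ r ∧ ∀ t ∈ T, ¬ Compatible r t ∨ t ≤ r := by
  induction T, hT using Set.Finite.induction_on generalizing p with
  | empty => exact ⟨p, le_rfl, by simp⟩
  | @insert t T _ _ ih =>
    obtain ⟨r, hpr, hr⟩ := ih p
    have hmono : ∀ r', r ≤ r' → ∀ t ∈ T, ¬ Compatible r' t ∨ t ≤ r' := fun r' hr' t ht =>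
      (hr t ht).imp (fun h ⟨c, h₁, h₂⟩ => h ⟨c, hr'.trans h₁, h₂⟩) fun h => h.trans hr'
    by_cases hc : Compatible r t
    · obtain ⟨r', hr', ht⟩ := hc
      exact ⟨r', hpr.trans hr', Set.forall_mem_insert.2 ⟨Or.inr ht, hmono r' hr'⟩⟩
    · exact ⟨r, hpr, Set.forall_mem_insert.2 ⟨Or.inl hc, hr⟩⟩

namespace PName

/-- The conditions which force `x ∈ j.2` and extend `j.1`, i.e. force that `j` contributes the
element `j.2` to a name having `j` among its pairs. -/
def decides (j : P × PName P) (x : PName P) : Set P := {a | j.1 ≤ a ∧ ForcesMem x j.2 a}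

theorem decides_mono {j : P × PName P} {x : PName P} {a b : P} (h : a ∈ decides j x)
    (hab : a ≤ b) : b ∈ decides j x :=
  ⟨h.1.trans hab, h.2.mono hab⟩

/-- `S` is a name of `B` by pairs (condition, element). -/
def IsCover (S : Set (P × PName P)) (B : PName P) : Prop :=
  (∀ j ∈ S, ForcesMem j.2 B j.1) ∧
    ∀ V p, ForcesMem V B p → ∃ r, p ≤ r ∧ ∃ j ∈ S, j.1 ≤ r ∧ ForcesEq V j.2 r

end PName

namespace ForcingName.IsIterablySweet

variable {Q : ForcingName P} {B : PName P} {S : Set (P × PName P)}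

theorem decides_of_le (hB : Q.IsIterablySweet B) (hS : IsCover S B) {j : P × PName P}
    (hj : j ∈ S) {x y : PName P} {a : P} (hx : ForcesMem x Q.carrier a) (hxy : Q.Le x y a)
    (hy : a ∈ decides j y) : a ∈ decides j x :=
  ⟨hy.1, hB.mem_of_le ((hS.1 j hj).mono hy.1) hx hy.2 hxy⟩

/-- The conditions `t.1` may be incompatible with each other, so the sets in which the bound must
lie depend on the generic filter. The bound is found locally, inside the intersection of the sets
that are active there, and the local bounds are mixed into one name. -/
theorem exists_bound_name (hB : Q.IsIterablySweet B) (hS : IsCover S B)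
    {p : P} {x x' : PName P} {s : ℕ → PName P} {i : P × PName P} {T : Set (P × (P × PName P))}
    (hT : T.Finite) (hx : Forced (SetFormula.mem x Q.carrier))
    (hx' : Forced (SetFormula.mem x' Q.carrier)) (hle : Q.Le x x' p) (hiS : i ∈ S)
    (hix' : p ∈ decides i x') (his : ∀ n, p ∈ decides i (s n)) (hTS : ∀ t ∈ T, t.2 ∈ S)
    (hTx' : ∀ t ∈ T, t.1 ∈ decides t.2 x') (hTs : ∀ t ∈ T, ∀ n, t.1 ∈ decides t.2 (s n))
    (hTp : ∀ t ∈ T, p ≤ t.1)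
    (hconv : ∀ j ∈ S, ∀ b, p ≤ b → b ∈ decides j x →
      ∃ c, b ≤ c ∧ ∀ᶠ n in atTop, c ∈ decides j (s n)) :
    ∃ y, Forced (SetFormula.mem y Q.carrier) ∧ (∀ n, Q.Le (s n) y p) ∧ Q.Le x' y p ∧
      p ∈ decides i y ∧ ∀ t ∈ T, t.1 ∈ decides t.2 y := by
  let Φ : PName P → P → Prop := fun y b => ForcesMem y Q.carrier b ∧ (¬ Compatible b p ∨
    (p ≤ b ∧ (∀ n, Q.Le (s n) y b) ∧ Q.Le x' y b ∧ ForcesMem y i.2 b ∧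
      ∀ t ∈ T, ¬ Compatible b t.1 ∨ ForcesMem y t.2.2 b))
  have hΦ : ∀ b, ∃ c, b ≤ c ∧ ∃ y, Φ y c := by
    intro b
    by_cases hbp : Compatible b p
    swap
    · exact ⟨b, le_rfl, x', hx' b, Or.inl hbp⟩
    obtain ⟨b₁, hb₁, hpb₁⟩ := hbp
    obtain ⟨b₂, hb₂, hdec⟩ := exists_le_and_forall_decided (hT.image Prod.fst) b₁
    have hpb₂ := hpb₁.trans hb₂
    have hsQ : ∀ n c, b₂ ≤ c → ForcesMem (s n) Q.carrier c := fun n c hc =>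
      (hB.mem_carrier ((hS.1 i hiS).mono (his n).1) (his n).2).mono (hpb₂.trans hc)
    -- `W` intersects `i.2` with the sets `t.2.2` whose condition is already met; the other `t.1`
    -- are incompatible with `b₂` and impose nothing.
    obtain ⟨b₃, hb₃, W, hW, hWmem⟩ := hB.exists_finite_inter
      (hT.subset (Set.sep_subset T fun t => t.1 ≤ b₂)) (fun t => t.2.2)
      ((hS.1 i hiS).mono (hix'.1.trans hpb₂))
      (fun t ht => (hS.1 t.2 (hTS t ht.1)).mono ((hTx' t ht.1).1.trans ht.2))
    have hpb₃ := hpb₂.trans hb₃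
    have hx'W : ForcesMem x' W b₃ := (hWmem x' b₃ le_rfl).2
      ⟨hix'.2.mono hpb₃, fun t ht => (hTx' t ht.1).2.mono (ht.2.trans hb₃)⟩
    have hsW : ∀ n, ForcesMem (s n) W b₃ := fun n => (hWmem (s n) b₃ le_rfl).2
      ⟨(his n).2.mono hpb₃, fun t ht => (hTs t ht.1 n).2.mono (ht.2.trans hb₃)⟩
    have hxW : ForcesMem x W b₃ := hB.mem_of_le hW (hx b₃) hx'W (hle.mono hpb₃)
    -- Convergence is known only along `S`, but every element of `B` is densely equal to a member of
    -- the cover.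
    obtain ⟨b₄, hb₄, z, hz, hsz, -⟩ := hB.exists_bound hW hsW hxW fun V q hq hV hxV => by
      obtain ⟨r, hr, j, hj, hjr, he⟩ := hS.2 V q hV
      obtain ⟨c, hc, hcs⟩ := hconv j hj r (hpb₃.trans (hq.trans hr))
        ⟨hjr, (hxV.mono hr).congr_right he⟩
      exact ⟨c, hr.trans hc, hcs.mono fun n hn => hn.2.congr_right (he.mono hc).symm⟩
    -- The bound `z` need not be above `x'`; directedness of `W` repairs this without leaving `W`.
    obtain ⟨b₅, hb₅, y, hy, hzy, hx'y⟩ := hB.directed (hW.mono hb₄) hz (hx'W.mono hb₄)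
    have h₃₅ := hb₄.trans hb₅
    have h₂₅ := hb₃.trans h₃₅
    have hyQ := hB.mem_carrier (hW.mono h₃₅) hy
    have hzQ := (hB.mem_carrier (hW.mono hb₄) hz).mono hb₅
    have hymem := (hWmem y b₅ h₃₅).1 hy
    refine ⟨b₅, hb₁.trans (hb₂.trans h₂₅), y, hyQ, Or.inr ⟨hpb₂.trans h₂₅, fun n =>
      ((hsz n).mono hb₅).trans hzy (hsQ n b₅ h₂₅) hzQ hyQ, hx'y, hymem.1, fun t ht => ?_⟩⟩
    rcases hdec t.1 ⟨t, ht, rfl⟩ with h | h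
    · exact Or.inl fun ⟨c, h₁, h₂⟩ => h ⟨c, h₂₅.trans h₁, h₂⟩
    · exact Or.inr (hymem.2 t ⟨ht, h⟩)
  obtain ⟨y, hy⟩ := exists_forall_dense hΦ
  have key : ∀ b, p ≤ b → ∃ r, b ≤ r ∧ ∃ z, ForcesEq z y r ∧ (∀ n, Q.Le (s n) z r) ∧
      Q.Le x' z r ∧ ForcesMem z i.2 r ∧ ∀ t ∈ T, t.1 ≤ b → ForcesMem z t.2.2 r := by
    intro b hb
    obtain ⟨r, hr, c, hcr, z, ⟨-, hz⟩, he⟩ := hy b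
    refine ⟨r, hr, z, he.symm, ?_⟩
    rcases hz with hz | ⟨-, h₁, h₂, h₃, h₄⟩
    · exact (hz ⟨r, hcr, hb.trans hr⟩).elim
    · exact ⟨fun n => (h₁ n).mono hcr, h₂.mono hcr, h₃.mono hcr, fun t ht htb =>
        ((h₄ t ht).resolve_left (not_not.2 ⟨r, hcr, htb.trans hr⟩)).mono hcr⟩
  refine ⟨y, fun b => ForcesMem.of_dense fun c _ => ?_, fun n => Le.of_dense fun b hb => ?_,
    Le.of_dense fun b hb => ?_, ⟨hix'.1, ForcesMem.of_dense fun b hb => ?_⟩,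
    fun t ht => ⟨(hTx' t ht).1, ForcesMem.of_dense fun b hb => ?_⟩⟩
  · obtain ⟨r, hr, d, hdr, z, ⟨hz, -⟩, he⟩ := hy c
    exact ⟨r, hr, (hz.mono hdr).congr_left he.symm⟩
  · obtain ⟨r, hr, z, he, h₁, -⟩ := key b hb
    exact ⟨r, hr, (h₁ n).congr (ForcesEq.refl _ _) he⟩
  · obtain ⟨r, hr, z, he, -, h₂, -⟩ := key b hb
    exact ⟨r, hr, h₂.congr (ForcesEq.refl _ _) he⟩
  · obtain ⟨r, hr, z, he, -, -, h₃, -⟩ := key b hb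
    exact ⟨r, hr, h₃.congr_left he⟩
  · obtain ⟨r, hr, z, he, -, -, -, h₄⟩ := key b ((hTp t ht).trans hb)
    exact ⟨r, hr, (h₄ t ht hb).congr_left he⟩

end ForcingName.IsIterablySweet

end

/-! ### The dense subset and its topology. -/

section

namespace Iteration

variable {P : Type u} [Preorder P] {Q : ForcingName P}

/-- The conditions `s` for which some `a ∈ V` above `s.fst` decides that `s.snd` belongs to the
element `j`, the weakest second coordinate being excluded. -/
def decidedIn (V : Set P) (j : P × PName P) : Set (Iteration Q) :=
  {s | s.snd ≠ Q.weakest ∧ ∃ a ∈ V, s.fst ≤ a ∧ a ∈ decides j s.snd}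

/-- The conditions whose second coordinate is the weakest condition, or belongs to `N`, is forced
to differ from the weakest condition, and is forced to belong to one of the sets in `S`. -/
def decidedSet (Q : ForcingName P) (S : Set (P × PName P)) (N : Set (PName P)) :
    Set (Iteration Q) :=
  {s | s.snd = Q.weakest ∨ (s.snd ∈ N ∧ (∀ r, s.fst ≤ r → ¬ ForcesEq s.snd Q.weakest r) ∧
    ∃ j ∈ S, s.fst ∈ decides j s.snd)}

/-- A subbasis of the topology on `decidedSet Q S N`. -/
def subbasis (𝒱 : Set (Set P)) (Q : ForcingName P) (S : Set (P × PName P)) (N : Set (PName P)) :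
    Set (Set (decidedSet Q S N)) :=
  insert {s | s.1.snd = Q.weakest} ((fun V => {s | s.1.fst ∈ V}) '' 𝒱 ∪
    Set.image2 (fun V j => {s | s.1 ∈ decidedIn V j}) 𝒱 S)

variable {S : Set (P × PName P)} {N : Set (PName P)} {𝒱 : Set (Set P)}

/-- It makes the copy of `P` downward closed in the dense set. -/
theorem decidedSet_snd_eq_weakest {s : Iteration Q} (hs : s ∈ decidedSet Q S N) {r : P}
    (hr : s.fst ≤ r) (h : ForcesEq s.snd Q.weakest r) : s.snd = Q.weakest :=
  hs.resolve_right fun h' => h'.2.1 r hr h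

theorem small_decidedSet (hN : Small.{u} N) : Small.{u} (decidedSet Q S N) := by
  have : Small.{u} (insert Q.weakest N : Set (PName P)) := small_insert _ _
  refine small_of_injective (β := P × (insert Q.weakest N : Set (PName P)))
    (f := fun s => (s.1.fst, ⟨s.1.snd, s.2.imp id fun h => h.1⟩)) ?_
  rintro ⟨⟨a, b, _⟩, _⟩ ⟨⟨a', b', _⟩, _⟩ h
  obtain ⟨ha, hb⟩ := Prod.mk.inj h
  obtain rfl : a = a' := ha
  obtain rfl : b = b' := congrArg Subtype.val hb
  rfl

theorem isDenseSubset_decidedSet {B : PName P} (hB : Q.IsIterablySweet B) (hS : IsCover S B)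
    (hN : ∀ x, Forced (SetFormula.mem x Q.carrier) → ∃ x' ∈ N, ∀ p, ForcesEq x x' p) :
    IsDenseSubset (decidedSet Q S N) := by
  rintro ⟨p, x, hx⟩
  by_cases h : ∃ r, p ≤ r ∧ ForcesEq x Q.weakest r
  · obtain ⟨r, hr, he⟩ := h
    exact ⟨embed Q r, Or.inl rfl, hr,
      ForcingName.Le.congr (ForcingName.le_refl (hx r)) (ForcesEq.refl _ _) he⟩
  · push Not at h
    obtain ⟨x', hx'N, hx'⟩ := hN x hx
    obtain ⟨r, hr, U, hU, hxU⟩ := hB.exists_mem (hx p)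
    obtain ⟨t, ht, j, hj, hjt, he⟩ := hS.2 U r hU
    refine ⟨⟨t, x', fun q => (hx q).congr_left (hx' q)⟩, Or.inr ⟨hx'N, fun q hq h' =>
      h q ((hr.trans ht).trans hq) ((hx' q).trans h'), j, hj, hjt,
      ((hxU.mono ht).congr_left (hx' t)).congr_right he⟩, hr.trans ht,
      ForcingName.Le.congr (ForcingName.le_refl (hx t)) (ForcesEq.refl _ _) (hx' t)⟩

/-- Membership in `decidedSet` survives strengthening the first coordinate, so if `r` is above `p`
and `a`, then `(r, x)` is a common bound of `(p, x)` and the image of `a`. -/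
theorem isCompleteSuborder_embed (hR : ∀ p, embed Q p ∈ decidedSet Q S N) :
    IsCompleteSuborder fun p : P => (⟨embed Q p, hR p⟩ : decidedSet Q S N) := by
  have hle : ∀ p q, (⟨embed Q p, hR p⟩ : decidedSet Q S N) ≤ ⟨embed Q q, hR q⟩ ↔ p ≤ q :=
    fun p q => ⟨fun h => h.1, fun h => ⟨h, ForcingName.le_refl (ForcingName.weakest_mem q)⟩⟩
  have hcomp : ∀ p q, Compatible (⟨embed Q p, hR p⟩ : decidedSet Q S N) ⟨embed Q q, hR q⟩ ↔
      Compatible p q := fun p q =>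
    ⟨fun ⟨r, h₁, h₂⟩ => ⟨r.1.fst, h₁.1, h₂.1⟩, fun ⟨r, h₁, h₂⟩ =>
      ⟨⟨embed Q r, hR r⟩, (hle _ _).2 h₁, (hle _ _).2 h₂⟩⟩
  refine ⟨fun p q h => congrArg (fun s : decidedSet Q S N => s.1.fst) h, hle, hcomp,
    fun A hA => ⟨?_, fun s => ?_⟩⟩
  · rintro _ ⟨p, hp, rfl⟩ _ ⟨q, hq, rfl⟩ hne h
    exact hA.1 hp hq (fun h' => hne (by rw [h'])) ((hcomp p q).1 h)
  · obtain ⟨⟨p, x, hx⟩, hs⟩ := s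
    obtain ⟨a, ha, r, hpr, har⟩ := hA.2 p
    refine ⟨_, ⟨a, ha, rfl⟩, ⟨⟨r, x, hx⟩, ?_⟩, ⟨hpr, ForcingName.le_refl (hx r)⟩,
      ⟨har, ForcingName.weakest_le (hx r)⟩⟩
    exact hs.imp id fun ⟨h₁, h₂, j, hj, h₃⟩ =>
      ⟨h₁, fun q hq => h₂ q (hpr.trans hq), j, hj, decides_mono h₃ hpr⟩

variable {τ : TopologicalSpace P}

/-- Along a subsequence of a convergent sequence in the iteration, the second coordinates are
forced to converge. -/
theorem exists_subseq (hP : IsTopologicalSweetnessModel P τ)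
    (h𝒱 : TopologicalSpace.IsTopologicalBasis 𝒱) (h𝒱c : 𝒱.Countable) (hSc : S.Countable)
    {s : ℕ → Iteration Q} {l : Iteration Q}
    (hfst : Tendsto (fun n => (s n).fst) atTop (𝓝 l.fst))
    (hweak : l.snd = Q.weakest → ∀ᶠ n in atTop, (s n).snd = Q.weakest)
    (hdec : ∀ V ∈ 𝒱, ∀ j ∈ S, l ∈ decidedIn V j → ∀ᶠ n in atTop, s n ∈ decidedIn V j) :
    ∃ φ : ℕ → ℕ, StrictMono φ ∧ ∀ b, l.fst ≤ b → ∀ j ∈ S, b ∈ decides j l.snd → ∀ V ∈ 𝓝 b,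
      ∃ c ∈ V, b ≤ c ∧ ∀ᶠ n in atTop, c ∈ decides j (s (φ n)).snd ∧ (s (φ n)).fst ≤ c := by
  have := hP.secondCountable
  have := h𝒱c.to_subtype
  have := hSc.to_subtype
  -- The condition `r` need only lie in `V`, not above `b`; so countably many requirements suffice
  -- for all `b`.
  let E : 𝒱 × S → Set ℕ → Prop := fun i Y =>
    (∃ b ∈ i.1.1, l.fst ≤ b ∧ b ∈ decides i.2.1 l.snd) →
      ∃ r ∈ i.1.1, ∀ k ∈ Y, r ∈ decides i.2.1 (s k).snd ∧ (s k).fst ≤ r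
  have hE : ∀ i X, X.Infinite → ∃ Y ⊆ X, Y.Infinite ∧ E i Y := by
    rintro ⟨⟨V, hV⟩, ⟨j, hj⟩⟩ X hX
    by_cases hb : ∃ b ∈ V, l.fst ≤ b ∧ b ∈ decides j l.snd
    swap
    · exact ⟨X, subset_rfl, hX, fun h => (hb h).elim⟩
    obtain ⟨b, hbV, hlb, hbj⟩ := hb
    have hVb := h𝒱.mem_nhds hV hbV
    by_cases hl : l.snd = Q.weakest
    · obtain ⟨r, hrV, hbr, hinf⟩ := hP.exists_bound_of_infinite hfst hlb hVb hX
      refine ⟨_, fun n hn => hn.1.1, Nat.frequently_atTop_iff_infinite.1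
        ((Nat.frequently_atTop_iff_infinite.2 hinf).and_eventually (hweak hl)),
        fun _ => ⟨r, hrV, fun k hk => ⟨?_, hk.1.2⟩⟩⟩
      rw [hk.2, ← hl]
      exact decides_mono hbj hbr
    -- The deciding conditions `a m` are taken from neighbourhoods shrinking to `b`; they converge
    -- to `b`, so sweetness bounds infinitely many of them.
    · obtain ⟨W, hW, hWt⟩ := h𝒱.exists_seq b
      obtain ⟨ψ, hψ, hψX⟩ := extraction_forall_of_frequently
        (P := fun m k => k ∈ X ∧ s k ∈ decidedIn (W m) j) fun m =>
          (Nat.frequently_atTop_iff_infinite.2 hX).and_eventually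
            (hdec (W m) (hW m).1 j hj ⟨hl, b, (hW m).2, hlb, hbj⟩)
      choose hX' _ a haW hsa haj using hψX
      obtain ⟨r, hrV, hbr, hinf⟩ := hP.sweet a b b V (hWt a haW) le_rfl hVb
      refine ⟨ψ '' {m | a m ≤ r}, ?_, hinf.image hψ.injective.injOn, fun _ => ⟨r, hrV, ?_⟩⟩
      · rintro _ ⟨m, -, rfl⟩
        exact hX' m
      · rintro _ ⟨m, hm, rfl⟩
        exact ⟨decides_mono (haj m) hm, (hsa m).trans hm⟩
  obtain ⟨φ, hφ, hφE⟩ := exists_strictMono_forall_eventually_mem hE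
  refine ⟨φ, hφ, fun b hlb j hj hbj V hV => ?_⟩
  obtain ⟨W, hW, hWt⟩ := h𝒱.exists_seq b
  have h : ∀ m, ∃ r ∈ W m, ∀ᶠ n in atTop, r ∈ decides j (s (φ n)).snd ∧ (s (φ n)).fst ≤ r := by
    intro m
    obtain ⟨Y, hY, hφY⟩ := hφE (⟨W m, (hW m).1⟩, ⟨j, hj⟩)
    obtain ⟨r, hr, hrY⟩ := hY ⟨b, (hW m).2, hlb, hbj⟩
    exact ⟨r, hr, hφY.mono fun n hn => hrY _ hn⟩
  choose r hrW hr using h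
  -- The conditions `r m` converge to `b`; a further use of sweetness gives a condition that is
  -- above `b` and some `r m`.
  obtain ⟨c, hcV, hbc, hinf⟩ := hP.sweet r b b V (hWt r hrW) le_rfl hV
  obtain ⟨m, hm⟩ := hinf.nonempty
  exact ⟨c, hcV, hbc, (hr m).mono fun n hn => ⟨decides_mono hn.1 hm, hn.2.trans hm⟩⟩

/-- The new first coordinate is one of the conditions `p m ≥ l'.fst` converging to `l'.fst`, each of
which bounds a tail of the first coordinates. The new second coordinate is a bound of the same tail
and of `l'.snd`. -/
theorem exists_bound_of_tendsto (hP : IsTopologicalSweetnessModel P τ)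
    (h𝒱 : TopologicalSpace.IsTopologicalBasis 𝒱) (h𝒱c : 𝒱.Countable) (hSc : S.Countable)
    {B : PName P} (hB : Q.IsIterablySweet B) (hS : IsCover S B)
    (hN : ∀ x, Forced (SetFormula.mem x Q.carrier) → ∃ x' ∈ N, ∀ p, ForcesEq x x' p)
    {s : ℕ → Iteration Q} {l : Iteration Q} {l' : decidedSet Q S N} (hll' : l ≤ l'.1)
    (hl' : l'.1.snd ≠ Q.weakest)
    (hfst : Tendsto (fun n => (s n).fst) atTop (𝓝 l.fst))
    (hweak : l.snd = Q.weakest → ∀ᶠ n in atTop, (s n).snd = Q.weakest)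
    (hdec : ∀ V ∈ 𝒱, ∀ j ∈ S, l ∈ decidedIn V j → ∀ᶠ n in atTop, s n ∈ decidedIn V j)
    {F : Set (Set (decidedSet Q S N))} (hF : F.Finite) (hFsub : F ⊆ subbasis 𝒱 Q S N)
    (hFl' : ∀ O ∈ F, l' ∈ O) :
    ∃ r : decidedSet Q S N, (∀ O ∈ F, r ∈ O) ∧ l' ≤ r ∧ {n | s n ≤ r.1}.Infinite := by
  have := hP.secondCountable
  obtain ⟨φ, hφ, hsub⟩ := exists_subseq hP h𝒱 h𝒱c hSc hfst hweak hdec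
  obtain ⟨-, hl'ne, i, hiS, hi⟩ := l'.2.resolve_left hl'
  have hdecl : ∀ j ∈ S, ∀ a, l'.1.fst ≤ a → a ∈ decides j l'.1.snd → a ∈ decides j l.snd :=
    fun j hj a hla ha => hB.decides_of_le hS hj (l.snd_mem a) (hll'.2.mono hla) ha
  obtain ⟨W, hW, hWt⟩ := h𝒱.exists_seq l'.1.fst
  choose p hpW hl'p hps using fun m => hsub l'.1.fst hll'.1 i hiS (hdecl i hiS _ le_rfl hi) (W m)
    (h𝒱.mem_nhds (hW m).1 (hW m).2)
  have hp := hWt p hpW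
  -- The demands of `F` become finitely many decisions `T` about the second coordinate and an
  -- infinite set `M` of admissible indices for the first.
  obtain ⟨T, M, hT, hM, hTdec, hTM, hTF⟩ : ∃ (T : Set (P × (P × PName P))) (M : Set ℕ),
      T.Finite ∧ M.Infinite ∧
      (∀ t ∈ T, t.2 ∈ S ∧ t.1 ∈ decides t.2 l'.1.snd ∧
        ∀ᶠ n in atTop, t.1 ∈ decides t.2 (s (φ n)).snd) ∧
      (∀ m ∈ M, ∀ t ∈ T, p m ≤ t.1) ∧
      ∀ r : decidedSet Q S N, r.1.snd ≠ Q.weakest → (∃ m ∈ M, r.1.fst = p m) →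
        (∀ t ∈ T, t.1 ∈ decides t.2 r.1.snd) → ∀ O ∈ F, r ∈ O := by
    induction F, hF using Set.Finite.induction_on with
    | empty => exact ⟨∅, Set.univ, by simp, Set.infinite_univ, by simp, by simp, by simp⟩
    | @insert O F _ _ ih =>
      obtain ⟨T, M, hT, hM, hTdec, hTM, hTF⟩ := ih ((Set.subset_insert _ _).trans hFsub)
        fun O' hO' => hFl' O' (Set.mem_insert_of_mem _ hO')
      have hl'O := hFl' O (Set.mem_insert _ _)
      rcases hFsub (Set.mem_insert O F) with rfl | ⟨V, hV, rfl⟩ | ⟨V, hV, j, hj, rfl⟩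
      · exact (hl' hl'O).elim
      · refine ⟨T, M ∩ {m | p m ∈ V}, hT, Nat.frequently_atTop_iff_infinite.1
          ((Nat.frequently_atTop_iff_infinite.2 hM).and_eventually
            (hp (h𝒱.mem_nhds hV hl'O))), hTdec, fun m hm => hTM m hm.1, ?_⟩
        rintro r hr ⟨m, hm, hrm⟩ hrT
        refine Set.forall_mem_insert.2 ⟨?_, hTF r hr ⟨m, hm.1, hrm⟩ hrT⟩
        change r.1.fst ∈ V
        rw [hrm]
        exact hm.2
      · obtain ⟨-, a, haV, hl'a, haj⟩ := hl'O
        obtain ⟨c, hcV, hac, hcs⟩ := hsub a (hll'.1.trans hl'a) j hj (hdecl j hj a hl'a haj) V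
          (h𝒱.mem_nhds hV haV)
        -- Since `p m` tends to `l'.fst ≤ c`, some `d ∈ V` above `c` bounds infinitely many `p m`;
        -- it will witness membership in `decidedIn V j`.
        obtain ⟨d, hdV, hcd, hinf⟩ := hP.exists_bound_of_infinite hp (hl'a.trans hac)
          (h𝒱.mem_nhds hV hcV) hM
        refine ⟨insert (d, j) T, _, hT.insert _, hinf, Set.forall_mem_insert.2 ⟨⟨hj,
          decides_mono haj (hac.trans hcd), hcs.mono fun n hn => decides_mono hn.1 hcd⟩, hTdec⟩,
          fun m hm => Set.forall_mem_insert.2 ⟨hm.2, hTM m hm.1⟩, ?_⟩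
        rintro r hr ⟨m, hm, hrm⟩ hrT
        obtain ⟨hrd, hrT⟩ := Set.forall_mem_insert.1 hrT
        refine Set.forall_mem_insert.2 ⟨⟨hr, d, hdV, ?_, hrd⟩, hTF r hr ⟨m, hm.1, hrm⟩ hrT⟩
        rw [hrm]
        exact hm.2
  obtain ⟨m, hm⟩ := hM.nonempty
  -- Beyond `K`, the condition `p m` and all of the finitely many `t ∈ T` make their decisions about
  -- every term.
  obtain ⟨K, hK⟩ := eventually_atTop.1
    ((hps m).and ((eventually_all_finite hT).2 fun t ht => (hTdec t ht).2.2))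
  obtain ⟨y, hyQ, hsy, hl'y, hyi, hyT⟩ := hB.exists_bound_name hS
    (s := fun n => (s (φ (n + K))).snd) hT l.snd_mem l'.1.snd_mem
    (ForcingName.Le.mono hll'.2 (hl'p m)) hiS (decides_mono hi (hl'p m))
    (fun n => (hK (n + K) (Nat.le_add_left _ _)).1.1) (fun t ht => (hTdec t ht).1)
    (fun t ht => (hTdec t ht).2.1) (fun t ht n => (hK (n + K) (Nat.le_add_left _ _)).2 t ht)
    (hTM m hm) fun j hj b hb hbj => by
      obtain ⟨c, -, hbc, hc⟩ := hsub b ((hll'.1.trans (hl'p m)).trans hb) j hj hbj Set.univ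
        univ_mem
      exact ⟨c, hbc, ((tendsto_add_atTop_nat K).eventually hc).mono fun n hn => hn.1⟩
  obtain ⟨y', hy'N, hyy'⟩ := hN y hyQ
  have hl'y' : Q.Le l'.1.snd y' (p m) := hl'y.congr (ForcesEq.refl _ _) (hyy' _)
  have hdecy : ∀ j a, a ∈ decides j y → a ∈ decides j y' := fun j a h =>
    ⟨h.1, h.2.congr_left (hyy' a)⟩
  -- A name above `l'.snd` that equals the weakest element would force `l'.snd` to be weakest too.
  have hy'ne : ∀ c, p m ≤ c → ¬ ForcesEq y' Q.weakest c := fun c hc he =>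
    hl'ne c ((hl'p m).trans hc) (((hl'y'.mono hc).congr (ForcesEq.refl _ _) he).eq_weakest
      (l'.1.snd_mem c))
  refine ⟨⟨⟨p m, y', fun q => (hyQ q).congr_left (hyy' q)⟩, Or.inr ⟨hy'N, hy'ne, i, hiS,
    hdecy _ _ hyi⟩⟩, hTF _ (fun h : y' = Q.weakest => hy'ne _ le_rfl (h ▸ ForcesEq.refl _ _))
    ⟨m, hm, rfl⟩ fun t ht => hdecy _ _ (hyT t ht), ⟨hl'p m, hl'y'⟩, ?_⟩
  refine (Set.infinite_range_of_injective
    (f := fun n => φ (n + K)) (hφ.injective.comp (add_left_injective K))).mono ?_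
  rintro _ ⟨n, rfl⟩
  exact ⟨(hK (n + K) (Nat.le_add_left _ _)).1.2, (hsy n).congr (ForcesEq.refl _ _) (hyy' _)⟩

end Iteration

/-! ### Assembly of the model. -/

open Iteration in
theorem mainTheorem5 {P : Type u} [Preorder P] (τ : TopologicalSpace P)
    (hP : IsTopologicalSweetnessModel P τ) (Q : ForcingName P) (B : PName P)
    (hQ : Forced (SetFormula.isIterableSweetnessModel Q.carrier Q.le B)) :
    ∃ (R : Set (Iteration Q)) (hR : ∀ p : P, Iteration.embed Q p ∈ R) (σ : TopologicalSpace R),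
      IsDenseSubset R ∧ Small.{u} R ∧ IsTopologicalSweetnessModel R σ ∧
        ExtendsModel (fun p : P => (⟨Iteration.embed Q p, hR p⟩ : R)) τ σ := by
  have hB := ForcingName.isIterablySweet_of_forced hQ
  obtain ⟨S, hSc, hS⟩ := hP.exists_countable_cover hB
  obtain ⟨N, hNs, hN⟩ := exists_small_representatives Q.carrier Q.weakest
    ForcingName.weakest_mem
  have := hP.secondCountable
  obtain ⟨𝒱, h𝒱c, -, h𝒱⟩ := TopologicalSpace.exists_countable_basis P
  have hR : ∀ p : P, embed Q p ∈ decidedSet Q S N := fun p => Or.inl rfl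
  let σ : TopologicalSpace (decidedSet Q S N) := .generateFrom (subbasis 𝒱 Q S N)
  have hopen : ∀ O ∈ subbasis 𝒱 Q S N, IsOpen O := fun O hO => .basic O hO
  have hweak : IsOpen {s : decidedSet Q S N | s.1.snd = Q.weakest} :=
    hopen _ (Set.mem_insert _ _)
  have hfst : Continuous fun s : decidedSet Q S N => s.1.fst :=
    h𝒱.continuous_iff.2 fun V hV => hopen _ (Or.inr (Or.inl ⟨V, hV, rfl⟩))
  have hmem_range : ∀ s : decidedSet Q S N, s.1.snd = Q.weakest →
      ∃ p : P, s = ⟨embed Q p, hR p⟩ := by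
    rintro ⟨⟨p, x, hx⟩, hs⟩ h
    obtain rfl : x = Q.weakest := h
    exact ⟨p, rfl⟩
  have hrange : Set.range (fun p : P => (⟨embed Q p, hR p⟩ : decidedSet Q S N)) =
      {s | s.1.snd = Q.weakest} := by
    ext s
    refine ⟨?_, fun h => (hmem_range s h).imp fun p hp => hp.symm⟩
    rintro ⟨p, rfl⟩
    rfl
  have hembed : Continuous fun p : P => (⟨embed Q p, hR p⟩ : decidedSet Q S N) := by
    refine continuous_generateFrom_iff.2 ?_
    rintro _ (rfl | ⟨V, hV, rfl⟩ | ⟨V, hV, j, hj, rfl⟩)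
    · convert isOpen_univ
      ext p
      exact ⟨fun _ => trivial, fun _ => rfl⟩
    · exact h𝒱.isOpen hV
    · convert isOpen_empty
      ext p
      exact ⟨fun h => h.1 rfl, False.elim⟩
  refine ⟨decidedSet Q S N, hR, σ, isDenseSubset_decidedSet hB hS hN, small_decidedSet hNs,
    ⟨⟨_, ?_, rfl⟩, ?_, ?_⟩, isCompleteSuborder_embed hR, hrange ▸ hweak, ?_⟩
  · exact ((h𝒱c.image _).union (h𝒱c.image2 hSc _)).insert _
  · obtain ⟨o, ho, hoo⟩ := hP.isolated_weakest
    refine ⟨⟨embed Q o, hR o⟩, ⟨fun s => ⟨ho.1 _, ForcingName.weakest_le (s.1.snd_mem _)⟩,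
      fun s hs => ?_⟩, ?_⟩
    · obtain ⟨p, rfl⟩ := hmem_range s (decidedSet_snd_eq_weakest s.2 hs.1
        (ForcingName.Le.eq_weakest hs.2 (s.1.snd_mem _)))
      obtain rfl := ho.2 p hs.1
      rfl
    · convert (hoo.preimage hfst).inter hweak
      ext s
      refine ⟨?_, fun ⟨h₁, h₂⟩ => ?_⟩
      · rintro rfl
        exact ⟨rfl, rfl⟩
      · obtain ⟨p, rfl⟩ := hmem_range s h₂
        obtain rfl : p = o := h₁
        rfl
  · intro s l l' W hs hll' hW
    have hs₁ : Tendsto (fun n => (s n).1.fst) atTop (𝓝 l.1.fst) := (hfst.tendsto l).comp hs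
    have hs₂ : l.1.snd = Q.weakest → ∀ᶠ n in atTop, (s n).1.snd = Q.weakest := fun h =>
      hs (hweak.mem_nhds h)
    by_cases hl' : l'.1.snd = Q.weakest
    -- Everything takes place in the copy of `P`: it contains `l` by downward closure and almost all
    -- `s n` because it is open.
    · obtain ⟨p', rfl⟩ := hmem_range l' hl'
      obtain ⟨p, rfl⟩ := hmem_range l (decidedSet_snd_eq_weakest l.2 hll'.1
        (ForcingName.Le.eq_weakest hll'.2 (l.1.snd_mem _)))
      obtain ⟨r, hrW, hr, hinf⟩ := hP.sweet _ p p' _ hs₁ hll'.1 (hembed.continuousAt hW)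
      refine ⟨⟨embed Q r, hR r⟩, hrW, ⟨hr, ForcingName.weakest_le (ForcingName.weakest_mem r)⟩,
        (Nat.frequently_atTop_iff_infinite.1 ((Nat.frequently_atTop_iff_infinite.2
          hinf).and_eventually (hs₂ rfl))).mono fun n hn => ?_⟩
      obtain ⟨q, hq⟩ := hmem_range (s n) hn.2
      have hqr : q ≤ r := by simpa [hq, embed] using hn.1
      change s n ≤ _
      rw [hq]
      exact ⟨hqr, ForcingName.weakest_le (ForcingName.weakest_mem r)⟩
    · obtain ⟨_, ⟨F, ⟨hF, hFsub⟩, rfl⟩, hFl', hFW⟩ :=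
        (TopologicalSpace.isTopologicalBasis_of_subbasis rfl).mem_nhds_iff.1 hW
      obtain ⟨r, hr, hl'r, hinf⟩ := exists_bound_of_tendsto hP h𝒱 h𝒱c hSc hB hS hN hll' hl' hs₁
        hs₂ (fun V hV j hj h => hs ((hopen _ (Or.inr (Or.inr ⟨V, hV, j, hj, rfl⟩))).mem_nhds h))
        hF hFsub hFl'
      exact ⟨r, hFW hr, hl'r, hinf⟩
  -- Both the embedding and the first projection are continuous, and their composition is the
  -- identity of `P`.
  · refine le_antisymm (continuous_iff_le_induced.1 hembed) ?_
    refine (induced_mono (continuous_iff_le_induced.1 hfst)).trans_eq ?_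
    rw [induced_compose]
    exact induced_id

end
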